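/- Let $\sigma>0$, $\delta\ge 1$, $b\ge 0$, $p\in(0,1)$, and let $\lambda:[0,\infty)\to[0,\infty)$ be a continuous function in $H^{1,2}_{loc}([0,\infty))$, i.e. $\lambda f\in H^{1,2}([0,\infty))$ for every $f\in C_0^1([0,\infty))$, with weak derivative $\partial_t\lambda\in L^2_{loc}([0,\infty))$. Put $$\beta(t)=\lambda(0)-\int_0^t(\partial_t\lambda)^-(s)\,ds,\qquad \gamma(t)=\int_0^t(\partial_t\lambda)^+(s)\,ds ,$$ $$E=\{(t,x)\in[0,\infty)\times\mathbb R:\ x\ge-\gamma(t)\},$$ $$\rho(t,x)=\Big((1-p)\,\mathbb I_{[-\gamma(t),\beta(t))}(x)+p\,\mathbb I_{[\beta(t),\infty)}(x)\Big)\,|x+\gamma(t)|^{\delta-1}e^{-bx^2/2},$$ and assume that $\rho(s,x)\le\rho(t,x)$ whenever $0\le s\le t$ and $x\ge-\gamma(s)$. Let $m(dx\,dt)=\rho(t,x)\,dx\,dt$ on $E$ and $\mathcal H=L^2(E,m)$ with inner product $(\cdot,\cdot)$. Let $C_0^1(E)$ be the set of restrictions to $E$ of compactly supported $C^1$ functions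 on $\mathbb R^2$, and let $(\mathcal A,\mathcal V)$ be the closure in $\mathcal H$ of $$\mathcal A(F,G)=\frac{\sigma^2}{8}\int_E\partial_xF\,\partial_xG\,dm,\qquad F,G\in C_0^1(E),$$ where $\mathcal V$ carries the norm $(\mathcal A(F,F)+(F,F))^{1/2}$, and $\mathcal V'$ is its dual, with pairing $\langle\cdot,\cdot\rangle$; $\mathcal H$ is mapped to $\mathcal V'$ by $K\mapsto(K,\cdot)$. Let $(\partial_t,D(\partial_t,\mathcal H))$ be the generator on $\mathcal H$ of the contraction semigroup $U_tF(s,x)=F(s+t,x)$, and let $(\partial_t,\mathcal F)$ be the closure, as an operator from $\mathcal V$ to $\mathcal V'$, of the restriction of $\partial_t$ to $D(\partial_t,\mathcal H)\cap\mathcal V$. The time-dependent generalized Dirichlet form is $\mathcal E(F,G)=\mathcal A(F,G)-\langle\partial_tF,G\rangle$ for $F\in\mathcal F$, $G\in\mathcal V$. Then for every $\alpha>0$ and $f\in\mathcal H$ there is exactly one $G_\alpha f\in\mathcal F$ such that $$\mathcal E(G_\alpha f,v)+\alpha\,(G_\alpha f,v)=(f,v)\qquad\text{for all }v\in\mathcal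 V,$$ and the resolvent $(G_\alpha)_{\alpha>0}$ is Markovian: for every $\alpha>0$, if $f\in\mathcal H$ and $0\le f\le1$ $m$-a.e., then $0\le\alpha G_\alpha f\le1$ $m$-a.e., and $\alpha G_\alpha\mathbb I_E=\mathbb I_E$ $m$-a.e.; in particular $$G_1\mathbb I_E=\mathbb I_E\quad m\text{-a.e.}$$ Here $G_\alpha\mathbb I_E$ is understood through the monotone extension of $G_\alpha$: sequences $(f_n)$ in $\mathcal H$ with $0\le f_n\uparrow\mathbb I_E$ $m$-a.e. exist, and for each of them $\alpha G_\alpha f_n\uparrow\mathbb I_E$ $m$-a.e. -/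

import Mathlib

open MeasureTheory Set Filter Topology

namespace MovingDomain

noncomputable section

/-! ### One-dimensional Sobolev spaces on the closed half line `[0, ∞)` -/

/-- `u ∈ C_0^1(X)`: continuously differentiable with compact support. -/
def IsC01 {X : Type*} [NormedAddCommGroup X] [NormedSpace ℝ X] (u : X → ℝ) : Prop :=
  ContDiff ℝ 1 u ∧ HasCompactSupport u

/-- `φ ∈ H^{1,2}(ℝ⁺)`: `φ` is in the completion of (the restrictions to `[0, ∞)` of) `C_0^1(ℝ)`
with respect to the norm `(∫_{[0,∞)} |φ'|² + |φ|²)^{1/2}`, realised inside `L²([0, ∞))`. -/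
def MemH12 (φ : ℝ → ℝ) : Prop :=
  ∃ ψ : ℝ → ℝ, MemLp ψ 2 (volume.restrict (Ici (0 : ℝ))) ∧
    ∃ f : ℕ → ℝ → ℝ, (∀ n, IsC01 (f n)) ∧
      Tendsto (fun n => eLpNorm (fun x => f n x - φ x) 2 (volume.restrict (Ici (0 : ℝ))))
        atTop (𝓝 0) ∧
      Tendsto (fun n => eLpNorm (fun x => deriv (f n) x - ψ x) 2 (volume.restrict (Ici (0 : ℝ))))
        atTop (𝓝 0)

/-- `φ ∈ H^{1,2}_loc(ℝ⁺)`: `φ` is continuous on `[0, ∞)` and `φ f ∈ H^{1,2}(ℝ⁺)` for every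
`f ∈ C_0^1(ℝ⁺)`. -/
def MemH12loc (φ : ℝ → ℝ) : Prop :=
  ContinuousOn φ (Ici 0) ∧ ∀ f : ℝ → ℝ, IsC01 f → MemH12 (fun x => φ x * f x)

/-- `φ'` is the weak derivative of `φ` on `(0, ∞)`, and it lies in `L²_loc([0, ∞))`. -/
def IsWeakDerivL2loc (φ φ' : ℝ → ℝ) : Prop :=
  (∀ T : ℝ, MemLp φ' 2 (volume.restrict (Icc 0 T))) ∧
    ∀ f : ℝ → ℝ, IsC01 f → tsupport f ⊆ Ioi 0 →
      ∫ x in Ioi (0 : ℝ), φ x * deriv f x = - ∫ x in Ioi (0 : ℝ), φ' x * f x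

/-! ### The moving domain and its reference measure -/

/-- The data: the constants `σ, δ, b, p`, the curve `λ` and its weak derivative `∂ₜλ`
(all conditions on them are hypotheses of the theorem). -/
structure Data where
  sigma : ℝ
  delta : ℝ
  b : ℝ
  p : ℝ
  lam : ℝ → ℝ
  dlam : ℝ → ℝ

variable (c : Data)

/-- The decreasing part `β(t) = λ(0) - ∫₀ᵗ (∂ₜλ)⁻`. -/
def beta (t : ℝ) : ℝ := -(∫ s in (0 : ℝ)..t, max (-(c.dlam s)) 0) + c.lam 0

/-- The increasing part `γ(t) = ∫₀ᵗ (∂ₜλ)⁺`. -/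
def gamma (t : ℝ) : ℝ := ∫ s in (0 : ℝ)..t, max (c.dlam s) 0

/-- The moving domain `E = {(t, x) : t ≥ 0, x ≥ -γ(t)}`. -/
def dom : Set (ℝ × ℝ) := {y | 0 ≤ y.1 ∧ -(gamma c y.1) ≤ y.2}

/-- The density `ρ(t, x)`. -/
def rho (t x : ℝ) : ℝ :=
  ((1 - c.p) * (Ico (-(gamma c t)) (beta c t)).indicator (fun _ => (1 : ℝ)) x
      + c.p * (Ici (beta c t)).indicator (fun _ => (1 : ℝ)) x)
    * |x + gamma c t| ^ (c.delta - 1) * Real.exp (-(c.b * x ^ 2 / 2))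

/-- `ρ(s, x) ≤ ρ(t, x)` for all `0 ≤ s ≤ t` and `x ∈ E_s`. -/
def RhoMonotone : Prop :=
  ∀ s t x : ℝ, 0 ≤ s → s ≤ t → (s, x) ∈ dom c → rho c s x ≤ rho c t x

/-- The reference measure `m(dx dt) = ρ(t, x) dx dt` on `E`. -/
def refMeasure : Measure (ℝ × ℝ) :=
  (volume.restrict (dom c)).withDensity (fun y => ENNReal.ofReal (rho c y.1 y.2))

/-- `𝓗 = L²(E, m)`. -/
abbrev H : Type := Lp ℝ 2 (refMeasure c)

/-! ### The symmetric part `(𝓐, 𝓥)` -/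

/-- The graph of `∂ₓ` on `C_0^1(E)`: the pairs `(F, ∂ₓF)` of `m`-classes, where `F` is the
restriction to `E` of some `u ∈ C_0^1(ℝ²)`. -/
def gradGraph : Submodule ℝ (WithLp 2 (H c × H c)) where
  carrier := {v | ∃ u : ℝ × ℝ → ℝ, IsC01 u ∧ v.fst =ᵐ[refMeasure c] u ∧
    v.snd =ᵐ[refMeasure c] fun y => deriv (fun x => u (y.1, x)) y.2}
  zero_mem' := by
    refine ⟨fun _ => 0, ⟨contDiff_const, HasCompactSupport.zero⟩, ?_, ?_⟩
    · exact Lp.coeFn_zero ℝ 2 (refMeasure c)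
    · filter_upwards [Lp.coeFn_zero ℝ 2 (refMeasure c)] with y e
      simp only [WithLp.zero_snd]
      rw [e, Pi.zero_apply, deriv_const]
  add_mem' := by
    rintro v w ⟨u, hu, h1, h2⟩ ⟨u', hu', h1', h2'⟩
    have hd : ∀ {u : ℝ × ℝ → ℝ}, IsC01 u → ∀ y : ℝ × ℝ,
        DifferentiableAt ℝ (fun x => u (y.1, x)) y.2 := fun hu y =>
      ((hu.1.differentiable one_ne_zero).comp (by fun_prop :
        Differentiable ℝ (fun x : ℝ => (y.1, x)))) y.2
    refine ⟨fun y => u y + u' y, ⟨hu.1.add hu'.1, hu.2.add hu'.2⟩, ?_, ?_⟩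
    · filter_upwards [h1, h1', Lp.coeFn_add v.fst w.fst] with y a b e
      simp only [WithLp.add_fst]
      rw [e, Pi.add_apply, a, b]
    · filter_upwards [h2, h2', Lp.coeFn_add v.snd w.snd] with y a b e
      simp only [WithLp.add_snd]
      rw [e, Pi.add_apply, a, b]
      exact (deriv_fun_add (hd hu y) (hd hu' y)).symm
  smul_mem' := by
    rintro r v ⟨u, hu, h1, h2⟩
    have hd : ∀ y : ℝ × ℝ, DifferentiableAt ℝ (fun x => u (y.1, x)) y.2 := fun y =>
      ((hu.1.differentiable one_ne_zero).comp (by fun_prop :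
        Differentiable ℝ (fun x : ℝ => (y.1, x)))) y.2
    refine ⟨fun y => r * u y, ⟨contDiff_const.mul hu.1, hu.2.mul_left⟩, ?_, ?_⟩
    · filter_upwards [h1, Lp.coeFn_smul r v.fst] with y a e
      simp only [WithLp.smul_fst]
      rw [e, Pi.smul_apply, a, smul_eq_mul]
    · filter_upwards [h2, Lp.coeFn_smul r v.snd] with y a e
      simp only [WithLp.smul_snd]
      rw [e, Pi.smul_apply, a, smul_eq_mul]
      exact (deriv_const_mul r (hd y)).symm

/-- `𝓥`: the closure of `C_0^1(E)` for the norm `𝓐₁^{1/2}`. The norm is equivalent to the graph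
norm of `∂ₓ`, so an element of `𝓥` is a pair `(F, ∂ₓF)` in the closed graph of `∂ₓ` in
`𝓗 × 𝓗`. -/
def V : Submodule ℝ (WithLp 2 (H c × H c)) := (gradGraph c).topologicalClosure

/-- The embedding `𝓥 → 𝓗`. -/
def toH (v : V c) : H c := (v : WithLp 2 (H c × H c)).fst

/-- The spatial derivative `∂ₓ : 𝓥 → 𝓗`. -/
def dx (v : V c) : H c := (v : WithLp 2 (H c × H c)).snd

/-- `𝓐(F, G) = σ²/8 ∫ ∂ₓF ∂ₓG ρ dx ds` on `𝓥`. -/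
def formA (u v : V c) : ℝ := c.sigma ^ 2 / 8 * inner ℝ (dx c u) (dx c v)

/-! ### The time derivative -/

/-- The translation semigroup `U_t F(s, x) = F(s + t, x)`. For `t ≥ 0` it maps `E` into itself. -/
def shift (t : ℝ) (F : ℝ × ℝ → ℝ) : ℝ × ℝ → ℝ := fun y => F (y.1 + t, y.2)

/-- `F` is in the domain `D(∂ₜ, 𝓗)` of the generator of `(U_t)` on `𝓗` and `∂ₜF = K`:
`(U_t F - F) / t → K` in `L²(E, m)` as `t ↓ 0`. -/
def HasTimeDeriv (F K : H c) : Prop :=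
  Tendsto (fun t : ℝ => eLpNorm (fun y => (shift t F y - F y) / t - K y) 2 (refMeasure c))
    (𝓝[>] 0) (𝓝 0)

/-- The graph of `(∂ₜ, 𝓕)`, that is, of the closure, as an operator from `𝓥` to `𝓥'`, of
`∂ₜ : D(∂ₜ, 𝓗) ∩ 𝓥 → 𝓗 ⊆ 𝓥'`, where `K ∈ 𝓗` acts on `𝓥` by `w ↦ (K, w)_𝓗`. -/
def timeGraph : Set (V c × StrongDual ℝ (V c)) :=
  closure {q | ∃ K : H c, HasTimeDeriv c (toH c q.1) K ∧
    ∀ w : V c, q.2 w = inner ℝ K (toH c w)}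

/-! ### The generalized Dirichlet form and its resolvent -/

/-- `𝓔_α(u, v) = 𝓐(u, v) - ⟨∂ₜu, v⟩ + α (u, v)_𝓗` for `u ∈ 𝓕` with `∂ₜu = ℓ ∈ 𝓥'`, `v ∈ 𝓥`. -/
def formE (α : ℝ) (u : V c) (ℓ : StrongDual ℝ (V c)) (v : V c) : ℝ :=
  formA c u v - ℓ v + α * inner ℝ (toH c u) (toH c v)

/-- `g = G_α f`: `g` is an element of `𝓕` with `𝓔_α(g, v) = (f, v)_𝓗` for all `v ∈ 𝓥`. -/
def IsResolvent (α : ℝ) (f g : H c) : Prop :=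
  ∃ q ∈ timeGraph c, toH c q.1 = g ∧ ∀ v : V c, formE c α q.1 q.2 v = inner ℝ f (toH c v)

/-- The resolvent `G_α : 𝓗 → 𝓗` of the generalized Dirichlet form. -/
def resolvent (α : ℝ) (f : H c) : H c := Classical.epsilon (IsResolvent c α f)

/-- `T : 𝓗 → 𝓗` is sub-Markovian: `0 ≤ f ≤ 1` `m`-a.e. implies `0 ≤ T f ≤ 1` `m`-a.e. -/
def IsSubMarkovian (T : H c → H c) : Prop :=
  ∀ f : H c, (∀ᵐ y ∂refMeasure c, 0 ≤ f y ∧ f y ≤ 1) →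
    ∀ᵐ y ∂refMeasure c, 0 ≤ T f y ∧ T f y ≤ 1

/-- `(a n)` is a sequence in `𝓗` with `0 ≤ a n ↑ f` `m`-a.e. -/
def IncreasesTo (a : ℕ → H c) (f : ℝ × ℝ → ℝ) : Prop :=
  ∀ᵐ y ∂refMeasure c, (∀ n, 0 ≤ a n y) ∧ Monotone (fun n => a n y) ∧
    Tendsto (fun n => a n y) atTop (𝓝 (f y))

/-- `T f = g` `m`-a.e. for the monotone extension of `T : 𝓗 → 𝓗` to functions `f ≥ 0` that need not
be square integrable: there are sequences `0 ≤ a n ↑ f` in `𝓗`, and for each of them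
`T (a n) ↑ g` `m`-a.e. -/
def ExtendsTo (T : H c → H c) (f g : ℝ × ℝ → ℝ) : Prop :=
  (∃ a : ℕ → H c, IncreasesTo c a f) ∧
    ∀ a : ℕ → H c, IncreasesTo c a f →
      ∀ᵐ y ∂refMeasure c, Monotone (fun n => T (a n) y) ∧
        Tendsto (fun n => T (a n) y) atTop (𝓝 (g y))

/-- The function `𝟙_E`. -/
def oneE : ℝ × ℝ → ℝ := (dom c).indicator (fun _ => 1)

end

end MovingDomain

namespace MovingDomain

noncomputable section

/-! Everything about time rests on one inequality. Since `E` is stable under forward translation and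
`ρ` grows in time, the image of `m` under `(s, x) ↦ (s + t, x)` is at most `m` (`map_fwd_le`). Hence
`U_t` contracts `𝓗` and `𝓥`, and `(∂ₜF, F) ≤ 0`.

Existence is a Lions argument (`exists_mem_closure_of_coercive`). On the closed graph of `∂ₜ`, the
map `(u, ℓ) ↦ 𝓐(u, ·) + α(u, ·) - ℓ` is bounded below, by coercivity and `ℓ(u) ≤ 0`, so its range is
closed. A vector `v` orthogonal to the range is tested with the averages `h⁻¹ ∫₀ʰ U_s v ds`, whose
time derivative is `h⁻¹ (U_h v - v)`. Letting `h ↓ 0` gives `𝓐_α(v, v) ≤ 0`, so `v = 0`. Uniqueness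
follows by testing with the solution itself.

For the Markov property, let `φ` be an increasing `C¹` function with `φ(0) = 0` and bounded
derivative. If `Φ' = φ`, convexity of `Φ` and `map_fwd_le` give `⟨∂ₜu, φ(u)⟩ ≤ 0`, while `𝓐(u, φ(u))
≥ 0`. So `(αu - f, φ(u)) ≤ 0` for `u = G_α f`, and choices of `φ` supported on `r < 0` or on `r >
1/α` give `0 ≤ αu ≤ 1` (`ae_of_isResolvent`).

For conservativeness, take the cut-off `w(t, x) = bump(t/T) bump(x/R)` with `R` at least `T`,
`γ(2T)` and `λ(0)`. Within `E`, `∂ₓw` lives on `R ≤ x ≤ 2R`, away from the boundary `-γ` and to the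
right of the jump at `β`. Integration by parts therefore produces no boundary or interface term, and
`w = G_α(αw - ∂ₜw - (σ²/8) Lw)` with `L = ρ⁻¹ ∂ₓ(ρ ∂ₓ ·)` (`isResolvent_barrier`). The drift `-bx`
has a favourable sign, so the right-hand side is at most `(α + D/T) 𝟙_K` with `K` compact
(`barrier_le`). Comparison gives `w ≤ (α + D/T) G_α 𝟙_K`, and `T → ∞` yields `1 ≤ α sup G_α f_n`. -/

/-- The hypotheses on the data that the construction uses. -/
structure Admissible (c : Data) : Prop where
  sigma_pos : 0 < c.sigma
  one_le_delta : 1 ≤ c.delta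
  b_nonneg : 0 ≤ c.b
  p_pos : 0 < c.p
  p_lt_one : c.p < 1
  memLp_dlam : ∀ T : ℝ, MemLp c.dlam 2 (volume.restrict (Icc 0 T))
  rho_monotone : RhoMonotone c

/-! ### Regularity of the boundary curves and bounds on the density -/

variable {c : Data}

/-- The integrand is controlled only to the right of `0`. Clamping the endpoint at `0` gives a
function continuous on all of `ℝ` that agrees with the primitive wherever `E` lives. -/
theorem continuous_primitive_max {F : ℝ → ℝ}
    (hF : ∀ t, 0 ≤ t → IntervalIntegrable F volume 0 t) :
    Continuous fun t => ∫ s in (0 : ℝ)..max t 0, F s := by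
  have key : ContinuousOn (fun t => ∫ s in (0 : ℝ)..t, F s) (Ici 0) := by
    intro t ht
    have ht : (0 : ℝ) ≤ t := ht
    have h0 : (0 : ℝ) ≤ t + 1 := by positivity
    have h := intervalIntegral.continuousOn_primitive_interval
      (((intervalIntegrable_iff_integrableOn_Icc_of_le h0).1
        (hF (t + 1) h0)).mono_set (by rw [uIcc_of_le h0]))
    rw [uIcc_of_le h0] at h
    refine (h t ⟨ht, by linarith⟩).mono_of_mem_nhdsWithin ?_
    rw [← Ici_inter_Iic]
    exact inter_mem self_mem_nhdsWithin (mem_nhdsWithin_of_mem_nhds (Iic_mem_nhds (by linarith)))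
  exact key.comp_continuous (by fun_prop) fun t => mem_Ici.2 (le_max_right _ _)

namespace Admissible

theorem intervalIntegrable_dlam (hc : Admissible c) {t : ℝ} (ht : 0 ≤ t) :
    IntervalIntegrable c.dlam volume 0 t := by
  rw [intervalIntegrable_iff_integrableOn_Icc_of_le ht]
  exact (hc.memLp_dlam t).integrable one_le_two

theorem intervalIntegrable_dlam_pos (hc : Admissible c) {t : ℝ} (ht : 0 ≤ t) :
    IntervalIntegrable (fun s => max (c.dlam s) 0) volume 0 t :=
  ⟨(hc.intervalIntegrable_dlam ht).1.pos_part, (hc.intervalIntegrable_dlam ht).2.pos_part⟩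

theorem intervalIntegrable_dlam_neg (hc : Admissible c) {t : ℝ} (ht : 0 ≤ t) :
    IntervalIntegrable (fun s => max (-(c.dlam s)) 0) volume 0 t :=
  ⟨(hc.intervalIntegrable_dlam ht).1.neg_part, (hc.intervalIntegrable_dlam ht).2.neg_part⟩

theorem continuous_gamma (hc : Admissible c) : Continuous fun t => gamma c (max t 0) :=
  continuous_primitive_max fun _ => hc.intervalIntegrable_dlam_pos

theorem continuous_beta (hc : Admissible c) : Continuous fun t => beta c (max t 0) :=
  (continuous_primitive_max fun _ => hc.intervalIntegrable_dlam_neg).neg.add continuous_const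

theorem gamma_mono (hc : Admissible c) {s t : ℝ} (hs : 0 ≤ s) (hst : s ≤ t) :
    gamma c s ≤ gamma c t :=
  intervalIntegral.integral_mono_interval le_rfl hs hst (ae_of_all _ fun _ => le_max_right _ _)
    (hc.intervalIntegrable_dlam_pos (hs.trans hst))

theorem gamma_nonneg {t : ℝ} (ht : 0 ≤ t) : 0 ≤ gamma c t :=
  intervalIntegral.integral_nonneg ht fun _ _ => le_max_right _ _

theorem beta_le {t : ℝ} (ht : 0 ≤ t) : beta c t ≤ c.lam 0 := by
  have : 0 ≤ ∫ s in (0 : ℝ)..t, max (-(c.dlam s)) 0 :=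
    intervalIntegral.integral_nonneg ht fun _ _ => le_max_right _ _
  unfold beta
  linarith

theorem rho_nonneg (hc : Admissible c) (t x : ℝ) : 0 ≤ rho c t x := by
  have h1 := hc.p_pos.le
  have h2 := sub_nonneg.2 hc.p_lt_one.le
  unfold rho
  have h3 : ∀ (s : Set ℝ), 0 ≤ s.indicator (fun _ => (1 : ℝ)) x := fun s =>
    indicator_nonneg (fun _ _ => zero_le_one) _
  have := h3 (Ico (-(gamma c t)) (beta c t))
  have := h3 (Ici (beta c t))
  positivity

theorem rho_le (hc : Admissible c) (t x : ℝ) :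
    rho c t x ≤ |x + gamma c t| ^ (c.delta - 1) := by
  have h1 := hc.p_pos.le
  have h2 := hc.p_lt_one.le
  have h3 : (1 - c.p) * (Ico (-(gamma c t)) (beta c t)).indicator (fun _ => (1 : ℝ)) x
      + c.p * (Ici (beta c t)).indicator (fun _ => (1 : ℝ)) x ≤ 1 := by
    by_cases h : beta c t ≤ x
    · rw [indicator_of_notMem (by simp [h]), indicator_of_mem (mem_Ici.2 h)]
      linarith
    · rw [indicator_of_notMem (s := Ici _) (by simpa using h)]
      have : (Ico (-(gamma c t)) (beta c t)).indicator (fun _ => (1 : ℝ)) x ≤ 1 :=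
        indicator_le_self' (fun _ _ => zero_le_one) _
      nlinarith
  have h4 : Real.exp (-(c.b * x ^ 2 / 2)) ≤ 1 := by
    rw [Real.exp_le_one_iff]
    have := mul_nonneg hc.b_nonneg (sq_nonneg x)
    linarith
  have h5 : 0 ≤ |x + gamma c t| ^ (c.delta - 1) := by positivity
  unfold rho
  calc _ ≤ 1 * |x + gamma c t| ^ (c.delta - 1) * 1 := by gcongr
    _ = _ := by ring

theorem measurableSet_dom (hc : Admissible c) : MeasurableSet (dom c) := by
  have : dom c = {y | 0 ≤ y.1 ∧ -(gamma c (max y.1 0)) ≤ y.2} := by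
    ext y
    simp only [dom, mem_ofPred_eq]
    refine and_congr_right fun h => ?_
    rw [max_eq_left h]
  rw [this]
  have := hc.continuous_gamma
  exact (measurableSet_le measurable_const measurable_fst).inter
    (measurableSet_le (this.comp continuous_fst).neg.measurable measurable_snd)

theorem mem_dom_of_le (hc : Admissible c) {s t x : ℝ} (h : (s, x) ∈ dom c) (hst : s ≤ t) :
    (t, x) ∈ dom c :=
  ⟨h.1.trans hst, (neg_le_neg (hc.gamma_mono h.1 hst)).trans h.2⟩

end Admissible

/-! ### Measurability of the density and local finiteness of `m` -/

variable (c) in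
/-- The density of `m` with respect to Lebesgue measure on `ℝ²`. -/
def dens : ℝ × ℝ → ENNReal := (dom c).indicator fun y => ENNReal.ofReal (rho c y.1 y.2)

namespace Admissible

theorem measurable_dens (hc : Admissible c) : Measurable (dens c) := by
  have : dens c = (dom c).indicator
      fun y => ENNReal.ofReal (rho c (max y.1 0) y.2) := by
    refine indicator_congr fun y hy => ?_
    rw [max_eq_left hy.1]
  rw [this]
  refine Measurable.indicator ?_ hc.measurableSet_dom
  have hg := (hc.continuous_gamma.comp continuous_fst : Continuous fun y : ℝ × ℝ =>
    gamma c (max y.1 0))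
  have hb := (hc.continuous_beta.comp continuous_fst : Continuous fun y : ℝ × ℝ =>
    beta c (max y.1 0))
  have h1 : Measurable fun y : ℝ × ℝ =>
      (Ico (-(gamma c (max y.1 0))) (beta c (max y.1 0))).indicator (fun _ => (1 : ℝ)) y.2 := by
    have : MeasurableSet {y : ℝ × ℝ |
        y.2 ∈ Ico (-(gamma c (max y.1 0))) (beta c (max y.1 0))} :=
      (measurableSet_le hg.neg.measurable measurable_snd).inter
        (measurableSet_lt measurable_snd hb.measurable)
    exact (measurable_const (a := (1 : ℝ))).indicator this
  have h2 : Measurable fun y : ℝ × ℝ =>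
      (Ici (beta c (max y.1 0))).indicator (fun _ => (1 : ℝ)) y.2 := by
    have : MeasurableSet {y : ℝ × ℝ | y.2 ∈ Ici (beta c (max y.1 0))} :=
      measurableSet_le hb.measurable measurable_snd
    exact (measurable_const (a := (1 : ℝ))).indicator this
  have h3 := hg.measurable
  unfold rho
  fun_prop

theorem refMeasure_eq (hc : Admissible c) : refMeasure c = volume.withDensity (dens c) := by
  rw [refMeasure, dens, withDensity_indicator hc.measurableSet_dom]

theorem ae_mem_dom (hc : Admissible c) : ∀ᵐ y ∂refMeasure c, y ∈ dom c :=
  (withDensity_absolutelyContinuous _ _).ae_le (ae_restrict_mem hc.measurableSet_dom)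

instance : SFinite (refMeasure c) := by unfold refMeasure; infer_instance

theorem refMeasure_lt_top_of_isCompact (hc : Admissible c) {K : Set (ℝ × ℝ)} (hK : IsCompact K) :
    refMeasure c K < ⊤ := by
  rw [hc.refMeasure_eq, withDensity_apply' _ K]
  have hcont : Continuous fun y : ℝ × ℝ => |y.2 + gamma c (max y.1 0)| ^ (c.delta - 1) := by
    have := (hc.continuous_gamma.comp continuous_fst : Continuous fun y : ℝ × ℝ =>
      gamma c (max y.1 0))
    refine Continuous.rpow_const (by fun_prop) fun _ => Or.inr (sub_nonneg.2 hc.one_le_delta)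
  obtain ⟨M, hM⟩ := (hK.image hcont).bddAbove
  calc ∫⁻ y in K, dens c y ≤ ∫⁻ y in K, ENNReal.ofReal M := by
        refine lintegral_mono_ae ?_
        filter_upwards [ae_restrict_mem hK.measurableSet] with y hy
        by_cases hd : y ∈ dom c
        · rw [dens, indicator_of_mem hd]
          refine ENNReal.ofReal_le_ofReal ((hc.rho_le _ _).trans ?_)
          have := hM (mem_image_of_mem _ hy)
          rwa [max_eq_left hd.1] at this
        · rw [dens, indicator_of_notMem hd]
          exact zero_le
    _ < ⊤ := by
      rw [lintegral_const, Measure.restrict_apply_univ]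
      exact ENNReal.mul_lt_top ENNReal.ofReal_lt_top hK.measure_lt_top

theorem isFiniteMeasureOnCompacts (hc : Admissible c) :
    IsFiniteMeasureOnCompacts (refMeasure c) :=
  ⟨fun _ hK => hc.refMeasure_lt_top_of_isCompact hK⟩

end Admissible

/-! ### Forward translation decreases `m` -/

/-- The forward time translation by `max t 0`. -/
def fwd (t : ℝ) (y : ℝ × ℝ) : ℝ × ℝ := (y.1 + max t 0, y.2)

theorem fwd_eq_add (t : ℝ) : fwd t = fun y => y + (max t 0, 0) := by
  ext y <;> simp [fwd]

theorem measurable_fwd (t : ℝ) : Measurable (fwd t) := by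
  unfold fwd; fun_prop

theorem Admissible.dens_le_dens_fwd (hc : Admissible c) (t : ℝ) (y : ℝ × ℝ) :
    dens c y ≤ dens c (fwd t y) := by
  by_cases hy : y ∈ dom c
  swap
  · rw [dens, indicator_of_notMem hy]
    exact zero_le
  have hst : y.1 ≤ y.1 + max t 0 := le_add_of_nonneg_right (le_max_right _ _)
  have hy' := hc.mem_dom_of_le (s := y.1) (x := y.2) hy hst
  rw [dens, fwd, indicator_of_mem hy', indicator_of_mem hy]
  exact ENNReal.ofReal_le_ofReal (hc.rho_monotone _ _ _ hy.1 hst hy)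

/-- Lebesgue measure is translation invariant and `dens` increases along `fwd t`. This is the only
route by which monotonicity of `ρ` enters later arguments. -/
theorem Admissible.map_fwd_le (hc : Admissible c) (t : ℝ) :
    (refMeasure c).map (fwd t) ≤ refMeasure c := by
  refine Measure.le_iff.2 fun A hA => ?_
  have hD := hc.measurable_dens
  rw [Measure.map_apply (measurable_fwd t) hA, hc.refMeasure_eq,
    withDensity_apply _ (measurable_fwd t hA), withDensity_apply _ hA,
    ← lintegral_indicator hA, ← lintegral_indicator (measurable_fwd t hA)]
  calc _ ≤ ∫⁻ y, A.indicator (dens c) (fwd t y) := by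
        refine lintegral_mono fun y => ?_
        by_cases hy : fwd t y ∈ A
        · rw [indicator_of_mem hy, indicator_of_mem (show y ∈ fwd t ⁻¹' A from hy)]
          exact hc.dens_le_dens_fwd t y
        · rw [indicator_of_notMem (show y ∉ fwd t ⁻¹' A from hy)]
          exact zero_le
    _ = _ := by
        rw [fwd_eq_add]
        exact lintegral_add_right_eq_self _ _

/-! ### Dominated convergence in `L²` -/

theorem tendsto_eLpNorm_of_dominated {α ι : Type*} {m : MeasurableSpace α} {μ : Measure α}
    {l : Filter ι} [l.IsCountablyGenerated] {f : ι → α → ℝ} {G : α → ℝ} (hG : MemLp G 2 μ)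
    (hf : ∀ᶠ i in l, AEStronglyMeasurable (f i) μ)
    (bound : ∀ᶠ i in l, ∀ᵐ y ∂μ, |f i y| ≤ G y)
    (lim : ∀ᵐ y ∂μ, Tendsto (fun i => f i y) l (𝓝 0)) :
    Tendsto (fun i => eLpNorm (f i) 2 μ) l (𝓝 0) := by
  have h2 : (2 : ENNReal) ≠ 0 := by norm_num
  have h2' : (2 : ENNReal) ≠ ⊤ := by norm_num
  have key : Tendsto (fun i => ∫⁻ y, ‖f i y‖ₑ ^ (2 : ℝ) ∂μ) l (𝓝 (∫⁻ _, 0 ∂μ)) := by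
    refine tendsto_lintegral_filter_of_dominated_convergence' (fun y => ‖G y‖ₑ ^ (2 : ℝ)) ?_ ?_ ?_ ?_
    · filter_upwards [hf] with i hi
      exact hi.enorm.pow_const _
    · filter_upwards [bound] with i hi
      filter_upwards [hi] with y hy
      refine ENNReal.rpow_le_rpow (enorm_le_iff_norm_le.2 ?_) zero_le_two
      rw [Real.norm_eq_abs, Real.norm_eq_abs]
      exact hy.trans (le_abs_self _)
    · have := (lintegral_rpow_enorm_lt_top_of_eLpNorm_lt_top h2 h2' hG.2).ne
      simpa using this
    · filter_upwards [lim] with y hy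
      have := (ENNReal.continuous_rpow_const (y := (2 : ℝ))).tendsto _ |>.comp hy.enorm
      simpa [Function.comp_def] using this
  rw [lintegral_zero] at key
  have := (ENNReal.continuous_rpow_const (y := (1 / 2 : ℝ))).tendsto _ |>.comp key
  rw [ENNReal.zero_rpow_of_pos (by norm_num)] at this
  refine this.congr fun i => ?_
  rw [eLpNorm_eq_lintegral_rpow_enorm_toReal h2 h2']
  simp

theorem tendsto_Lp_of_dominated {α ι : Type*} {m : MeasurableSpace α} {μ : Measure α}
    {l : Filter ι} [l.IsCountablyGenerated] {F : ι → Lp ℝ 2 μ} {F₀ : Lp ℝ 2 μ}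
    {f : ι → α → ℝ} {f₀ G : α → ℝ} (hG : MemLp G 2 μ)
    (hF : ∀ i, F i =ᵐ[μ] f i) (hF₀ : F₀ =ᵐ[μ] f₀)
    (bound : ∀ᶠ i in l, ∀ᵐ y ∂μ, |f i y - f₀ y| ≤ G y)
    (lim : ∀ᵐ y ∂μ, Tendsto (fun i => f i y) l (𝓝 (f₀ y))) :
    Tendsto F l (𝓝 F₀) := by
  rw [Lp.tendsto_Lp_iff_tendsto_eLpNorm']
  have h : ∀ i, ⇑(F i) - ⇑F₀ =ᵐ[μ] fun y => f i y - f₀ y := fun i => by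
    filter_upwards [hF i, hF₀] with y h1 h2
    rw [Pi.sub_apply, h1, h2]
  refine (tendsto_eLpNorm_of_dominated hG (Eventually.of_forall fun i => ?_) bound ?_).congr
    fun i => (eLpNorm_congr_ae (h i)).symm
  · exact ((Lp.aestronglyMeasurable (F i)).sub (Lp.aestronglyMeasurable F₀)).congr (h i)
  · filter_upwards [lim] with y hy
    simpa using hy.sub_const (f₀ y)

/-! ### The translation semigroup on `𝓗` -/

theorem fwd_of_nonneg {t : ℝ} (ht : 0 ≤ t) (y : ℝ × ℝ) : fwd t y = (y.1 + t, y.2) := by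
  rw [fwd, max_eq_left ht]

theorem continuous_fwd : Continuous fun z : ℝ × (ℝ × ℝ) => fwd z.1 z.2 := by
  unfold fwd; fun_prop

namespace Admissible

theorem quasiMeasurePreserving_fwd (hc : Admissible c) (t : ℝ) :
    Measure.QuasiMeasurePreserving (fwd t) (refMeasure c) (refMeasure c) :=
  ⟨measurable_fwd t, (hc.map_fwd_le t).absolutelyContinuous⟩

theorem ae_fwd (hc : Admissible c) (t : ℝ) {P : ℝ × ℝ → Prop} (h : ∀ᵐ y ∂refMeasure c, P y) :
    ∀ᵐ y ∂refMeasure c, P (fwd t y) :=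
  (hc.quasiMeasurePreserving_fwd t).ae h

theorem eLpNorm_comp_fwd_le (hc : Admissible c) (t : ℝ) (p : ENNReal) {F : ℝ × ℝ → ℝ}
    (hF : AEStronglyMeasurable F (refMeasure c)) :
    eLpNorm (F ∘ fwd t) p (refMeasure c) ≤ eLpNorm F p (refMeasure c) := by
  rw [← eLpNorm_map_measure (hF.mono_measure (hc.map_fwd_le t)) (measurable_fwd t).aemeasurable]
  exact eLpNorm_mono_measure _ (hc.map_fwd_le t)

theorem memLp_comp_fwd (hc : Admissible c) (t : ℝ) {p : ENNReal} {F : ℝ × ℝ → ℝ}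
    (hF : MemLp F p (refMeasure c)) : MemLp (F ∘ fwd t) p (refMeasure c) :=
  ⟨hF.1.comp_quasiMeasurePreserving (hc.quasiMeasurePreserving_fwd t),
    (hc.eLpNorm_comp_fwd_le t p hF.1).trans_lt hF.2⟩

theorem integral_comp_fwd_le (hc : Admissible c) (t : ℝ) {F : ℝ × ℝ → ℝ}
    (hF : Integrable F (refMeasure c)) (h0 : ∀ y, 0 ≤ F y) :
    ∫ y, F (fwd t y) ∂refMeasure c ≤ ∫ y, F y ∂refMeasure c := by
  rw [← integral_map (measurable_fwd t).aemeasurable (hF.1.mono_measure (hc.map_fwd_le t))]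
  exact integral_mono_measure (hc.map_fwd_le t) (ae_of_all _ h0) hF

/-- The translation `U_t` on `𝓗` (for `t < 0` it is the identity). -/
def translate (hc : Admissible c) (t : ℝ) : H c →L[ℝ] H c :=
  LinearMap.mkContinuous
    { toFun := fun F => (hc.memLp_comp_fwd t (Lp.memLp F)).toLp _
      map_add' := fun F G => by
        ext1
        filter_upwards [MemLp.coeFn_toLp (hc.memLp_comp_fwd t (Lp.memLp (F + G))),
          MemLp.coeFn_toLp (hc.memLp_comp_fwd t (Lp.memLp F)),
          MemLp.coeFn_toLp (hc.memLp_comp_fwd t (Lp.memLp G)),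
          Lp.coeFn_add (MemLp.toLp _ (hc.memLp_comp_fwd t (Lp.memLp F)))
            (MemLp.toLp _ (hc.memLp_comp_fwd t (Lp.memLp G))),
          hc.ae_fwd t (Lp.coeFn_add F G)] with y h1 h2 h3 h4 h5
        rw [h4, h1, Pi.add_apply, h2, h3]
        exact h5
      map_smul' := fun r F => by
        ext1
        filter_upwards [MemLp.coeFn_toLp (hc.memLp_comp_fwd t (Lp.memLp (r • F))),
          MemLp.coeFn_toLp (hc.memLp_comp_fwd t (Lp.memLp F)),
          Lp.coeFn_smul r (MemLp.toLp _ (hc.memLp_comp_fwd t (Lp.memLp F))),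
          hc.ae_fwd t (Lp.coeFn_smul r F)] with y h1 h2 h3 h4
        rw [RingHom.id_apply, h3, h1, Pi.smul_apply, h2]
        exact h4 } 1 fun F => by
    rw [one_mul]
    change ‖MemLp.toLp _ (hc.memLp_comp_fwd t (Lp.memLp F))‖ ≤ _
    rw [Lp.norm_toLp, Lp.norm_def]
    exact ENNReal.toReal_mono (Lp.memLp F).2.ne
      (hc.eLpNorm_comp_fwd_le t 2 (Lp.aestronglyMeasurable F))

theorem coeFn_translate (hc : Admissible c) (t : ℝ) (F : H c) :
    hc.translate t F =ᵐ[refMeasure c] fun y => F (fwd t y) :=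
  MemLp.coeFn_toLp (hc.memLp_comp_fwd t (Lp.memLp F))

theorem norm_translate_le (hc : Admissible c) (t : ℝ) (F : H c) : ‖hc.translate t F‖ ≤ ‖F‖ := by
  have := (hc.translate t).le_of_opNorm_le (LinearMap.mkContinuous_norm_le _ zero_le_one _) F
  rwa [one_mul] at this

theorem translate_translate (hc : Admissible c) {s t : ℝ} (hs : 0 ≤ s) (ht : 0 ≤ t) (F : H c) :
    hc.translate s (hc.translate t F) = hc.translate (t + s) F := by
  ext1
  filter_upwards [hc.coeFn_translate s (hc.translate t F),
    hc.ae_fwd s (hc.coeFn_translate t F), hc.coeFn_translate (t + s) F] with y h1 h2 h3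
  rw [h1, h2, h3, fwd_of_nonneg hs, fwd_of_nonneg ht, fwd_of_nonneg (add_nonneg ht hs)]
  simp only
  rw [add_right_comm, ← add_assoc]

theorem translate_zero (hc : Admissible c) (F : H c) : hc.translate 0 F = F := by
  ext1
  filter_upwards [hc.coeFn_translate 0 F] with y h1
  rw [h1, fwd_of_nonneg le_rfl, add_zero]

/-- Dissipativity, from Cauchy–Schwarz and contractivity. It is used for the sign of `∂ₜ` and again
for the density of the range. -/
theorem inner_translate_sub_le (hc : Admissible c) (t : ℝ) (F : H c) :
    inner ℝ (hc.translate t F - F) F ≤ 0 := by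
  rw [inner_sub_left, real_inner_self_eq_norm_mul_norm]
  have := real_inner_le_norm (hc.translate t F) F
  have := hc.norm_translate_le t F
  nlinarith [norm_nonneg F]

theorem hasTimeDeriv_iff (hc : Admissible c) (F K : H c) :
    HasTimeDeriv c F K ↔
      Tendsto (fun t : ℝ => t⁻¹ • (hc.translate t F - F)) (𝓝[>] 0) (𝓝 K) := by
  rw [Lp.tendsto_Lp_iff_tendsto_eLpNorm', HasTimeDeriv]
  refine tendsto_congr' ?_
  filter_upwards [self_mem_nhdsWithin] with t ht
  have ht : (0 : ℝ) < t := ht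
  refine eLpNorm_congr_ae ?_
  filter_upwards [hc.coeFn_translate t F, Lp.coeFn_smul t⁻¹ (hc.translate t F - F),
    Lp.coeFn_sub (hc.translate t F) F] with y h1 h2 h3
  rw [Pi.sub_apply, h2, Pi.smul_apply, h3, Pi.sub_apply, h1, fwd_of_nonneg ht.le, shift,
    smul_eq_mul, div_eq_inv_mul]

end Admissible

/-! ### Test functions -/

namespace IsC01

variable {u : ℝ × ℝ → ℝ}

theorem hasDerivAt_snd (hu : IsC01 u) (y : ℝ × ℝ) :
    HasDerivAt (fun x => u (y.1, x)) (fderiv ℝ u y (0, 1)) y.2 := by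
  have h1 : HasFDerivAt u (fderiv ℝ u y) (y.1, y.2) :=
    ((hu.1.differentiable one_ne_zero) y).hasFDerivAt
  exact h1.comp_hasDerivAt y.2 ((hasDerivAt_const y.2 y.1).prodMk (hasDerivAt_id y.2))

theorem hasDerivAt_fst (hu : IsC01 u) (y : ℝ × ℝ) :
    HasDerivAt (fun t => u (t, y.2)) (fderiv ℝ u y (1, 0)) y.1 := by
  have h1 : HasFDerivAt u (fderiv ℝ u y) (y.1, y.2) :=
    ((hu.1.differentiable one_ne_zero) y).hasFDerivAt
  exact h1.comp_hasDerivAt y.1 ((hasDerivAt_id y.1).prodMk (hasDerivAt_const y.1 y.2))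

theorem continuous_fderiv (hu : IsC01 u) (v : ℝ × ℝ) : Continuous fun y => fderiv ℝ u y v :=
  (hu.1.continuous_fderiv one_ne_zero).clm_apply continuous_const

theorem hasCompactSupport_fderiv (hu : IsC01 u) (v : ℝ × ℝ) :
    HasCompactSupport fun y => fderiv ℝ u y v :=
  (hu.2.fderiv ℝ).comp_left (g := fun L : ℝ × ℝ →L[ℝ] ℝ => L v) rfl

theorem comp_fwd (hu : IsC01 u) (t : ℝ) : IsC01 (u ∘ fwd t) := by
  have h : fwd t = Homeomorph.addRight ((max t 0, 0) : ℝ × ℝ) := by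
    rw [fwd_eq_add]; rfl
  refine ⟨?_, ?_⟩
  · rw [fwd_eq_add]
    exact hu.1.comp (contDiff_id.add contDiff_const)
  · rw [h]
    exact hu.2.comp_homeomorph _

end IsC01

theorem Admissible.memLp_of_continuous (hc : Admissible c) {g : ℝ × ℝ → ℝ} (hg : Continuous g)
    (hg' : HasCompactSupport g) (p : ENNReal) : MemLp g p (refMeasure c) :=
  have := hc.isFiniteMeasureOnCompacts
  hg.memLp_of_hasCompactSupport hg'

/-- The translates of a compact set by times up to `T`, backwards. -/
theorem exists_isCompact_fwd {K : Set (ℝ × ℝ)} (hK : IsCompact K) (T : ℝ) :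
    ∃ K' : Set (ℝ × ℝ), IsCompact K' ∧ K ⊆ K' ∧ ∀ t, t ≤ T → ∀ y, fwd t y ∈ K → y ∈ K' := by
  refine ⟨(fun z : ℝ × (ℝ × ℝ) => z.2 - (z.1, 0)) '' (Icc 0 (max T 0) ×ˢ K),
    (isCompact_Icc.prod hK).image (by fun_prop), fun y hy => ?_, fun t ht y hy => ?_⟩
  · exact ⟨(0, y), ⟨⟨le_rfl, le_max_right _ _⟩, hy⟩, by simp⟩
  · refine ⟨(max t 0, fwd t y), ⟨⟨le_max_right _ _, max_le_max_right 0 ht⟩, hy⟩, ?_⟩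
    ext <;> simp [fwd]

namespace Admissible

/-- For times up to `t₀ + 1` the translates of `g` are bounded by the same constant and vanish off
one compact set, so dominated convergence applies. -/
theorem continuous_translate_of_continuous (hc : Admissible c) {F : H c} {g : ℝ × ℝ → ℝ}
    (hg : Continuous g) (hg' : HasCompactSupport g) (hF : F =ᵐ[refMeasure c] g) :
    Continuous fun t => hc.translate t F := by
  rw [continuous_iff_continuousAt]
  intro t₀
  obtain ⟨M, hM⟩ := hg.bounded_above_of_compact_support hg'
  obtain ⟨K, hK, -, hK'⟩ := exists_isCompact_fwd hg' (t₀ + 1)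
  have hFt : ∀ t, hc.translate t F =ᵐ[refMeasure c] fun y => g (fwd t y) := fun t =>
    (hc.coeFn_translate t F).trans (hc.ae_fwd t hF)
  refine tendsto_Lp_of_dominated (G := K.indicator fun _ => 2 * M) ?_ hFt (hFt t₀) ?_ ?_
  · exact memLp_indicator_const 2 hK.measurableSet _
      (Or.inr (hc.refMeasure_lt_top_of_isCompact hK).ne)
  · filter_upwards [Iic_mem_nhds (lt_add_one t₀)] with t ht
    refine ae_of_all _ fun y => ?_
    by_cases hy : y ∈ K
    · rw [indicator_of_mem hy, two_mul]
      exact (abs_sub _ _).trans (add_le_add (hM _) (hM _))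
    · rw [indicator_of_notMem hy, image_eq_zero_of_notMem_tsupport fun h => hy (hK' t ht y h),
        image_eq_zero_of_notMem_tsupport fun h => hy (hK' t₀ (by linarith) y h), sub_zero, abs_zero]
  · exact ae_of_all _ fun y =>
      (hg.comp (continuous_fwd.comp (by fun_prop : Continuous fun t : ℝ => (t, y)))).continuousAt

/-- The difference quotients are bounded by a Lipschitz constant of `u` and, for `t < 1`, vanish off
one compact set; they converge pointwise to the classical derivative. -/
theorem hasTimeDeriv_of_isC01 (hc : Admissible c) {u : ℝ × ℝ → ℝ} (hu : IsC01 u) {F K : H c}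
    (hF : F =ᵐ[refMeasure c] u) (hK : K =ᵐ[refMeasure c] fun y => fderiv ℝ u y (1, 0)) :
    HasTimeDeriv c F K := by
  rw [hc.hasTimeDeriv_iff]
  obtain ⟨M, hM⟩ := hu.1.lipschitzWith_of_hasCompactSupport hu.2 one_ne_zero
  obtain ⟨S, hS, hSu, hS'⟩ := exists_isCompact_fwd hu.2 1
  have hMd : ∀ y, |fderiv ℝ u y (1, 0)| ≤ M := fun y => by
    have h1 := (fderiv ℝ u y).le_of_opNorm_le (norm_fderiv_le_of_lipschitz ℝ hM) (1, 0)
    simpa using h1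
  refine tendsto_Lp_of_dominated (G := S.indicator fun _ => 2 * (M : ℝ))
    (f := fun t y => t⁻¹ * (u (fwd t y) - u y)) ?_ (fun t => ?_) hK ?_ ?_
  · exact memLp_indicator_const 2 hS.measurableSet _
      (Or.inr (hc.refMeasure_lt_top_of_isCompact hS).ne)
  · filter_upwards [hc.coeFn_translate t F, Lp.coeFn_smul t⁻¹ (hc.translate t F - F),
      Lp.coeFn_sub (hc.translate t F) F, hF, hc.ae_fwd t hF] with y h1 h2 h3 h4 h5
    rw [h2, Pi.smul_apply, h3, Pi.sub_apply, h1, h4, h5, smul_eq_mul]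
  · filter_upwards [Ioo_mem_nhdsGT zero_lt_one] with t ht
    refine ae_of_all _ fun y => ?_
    by_cases hy : y ∈ S
    · rw [indicator_of_mem hy, two_mul]
      refine (abs_sub _ _).trans (add_le_add ?_ (hMd y))
      have h1 := hM.dist_le_mul (fwd t y) y
      rw [fwd_of_nonneg ht.1.le, Real.dist_eq, Prod.dist_eq] at h1
      rw [fwd_of_nonneg ht.1.le, abs_mul, abs_inv, abs_of_pos ht.1, inv_mul_le_iff₀ ht.1]
      have h2 : dist (y.1 + t) y.1 = t := by simp [abs_of_pos ht.1]
      simp only [h2, dist_self, max_eq_left ht.1.le] at h1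
      linarith
    · rw [indicator_of_notMem hy, image_eq_zero_of_notMem_tsupport fun h => hy (hS' t ht.2.le y h),
        image_eq_zero_of_notMem_tsupport fun h => hy (hSu h)]
      have : fderiv ℝ u y = 0 := image_eq_zero_of_notMem_tsupport fun h =>
        hy (hSu (tsupport_fderiv_subset ℝ h))
      simp [this]
  · refine ae_of_all _ fun y => ?_
    have h1 := (hasDerivAt_iff_tendsto_slope_zero.1 (hu.hasDerivAt_fst y)).mono_left
      (nhdsGT_le_nhdsNE 0)
    refine h1.congr' ?_
    filter_upwards [self_mem_nhdsWithin] with t ht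
    rw [fwd_of_nonneg (le_of_lt ht), smul_eq_mul]

end Admissible

theorem tendsto_inv_smul_integral {X : Type*} [NormedAddCommGroup X] [NormedSpace ℝ X]
    [CompleteSpace X] {f : ℝ → X} (hf : Continuous f) (a : ℝ) :
    Tendsto (fun t : ℝ => t⁻¹ • ∫ s in a..(a + t), f s) (𝓝[>] 0) (𝓝 (f a)) := by
  have hd := intervalIntegral.integral_hasDerivAt_right (hf.intervalIntegrable a a)
    (hf.stronglyMeasurableAtFilter _ _) hf.continuousAt
  have := (hasDerivAt_iff_tendsto_slope_zero.1 hd).mono_left (nhdsGT_le_nhdsNE 0)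
  simpa using this

/-! ### A Lions type existence theorem -/

section Abstract

variable {X : Type*} [NormedAddCommGroup X] [InnerProductSpace ℝ X] [CompleteSpace X]

variable (X) in
/-- The Riesz isomorphism of a real Hilbert space as a linear map. -/
def riesz : StrongDual ℝ X →L[ℝ] X :=
  LinearMap.mkContinuous
    { toFun := (InnerProductSpace.toDual ℝ X).symm
      map_add' := map_add _
      map_smul' := fun r ℓ => by simp } 1 fun ℓ => by simp

theorem inner_riesz (ℓ : StrongDual ℝ X) (v : X) : inner ℝ (riesz X ℓ) v = ℓ v :=
  InnerProductSpace.toDual_symm_apply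

theorem norm_riesz (ℓ : StrongDual ℝ X) : ‖riesz X ℓ‖ = ‖ℓ‖ :=
  (InnerProductSpace.toDual ℝ X).symm.norm_map ℓ

variable {B : X →L[ℝ] X} {κ : ℝ} {G : Submodule ℝ (X × StrongDual ℝ X)}

omit [CompleteSpace X] in
theorem nonpos_of_mem_closure (hG : ∀ q ∈ G, q.2 q.1 ≤ 0) {q : X × StrongDual ℝ X}
    (hq : q ∈ closure (G : Set (X × StrongDual ℝ X))) : q.2 q.1 ≤ 0 := by
  have hcl : IsClosed {q : X × StrongDual ℝ X | q.2 q.1 ≤ 0} :=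
    isClosed_le (continuous_snd.clm_apply continuous_fst) continuous_const
  exact closure_minimal hG hcl hq

/-- Pairing `B u - riesz ℓ` with `u` gives `⟨B u, u⟩ - ℓ(u) ≥ κ‖u‖²`, because `ℓ(u) ≤ 0`. -/
theorem norm_fst_le_of_coercive (hκ : 0 < κ) (hB : ∀ u, κ * ‖u‖ ^ 2 ≤ inner ℝ (B u) u)
    {q : X × StrongDual ℝ X} (hq : q.2 q.1 ≤ 0) : ‖q.1‖ ≤ κ⁻¹ * ‖B q.1 - riesz X q.2‖ := by
  have h1 := real_inner_le_norm (B q.1 - riesz X q.2) q.1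
  rw [inner_sub_left, inner_riesz] at h1
  have h2 := hB q.1
  rw [le_inv_mul_iff₀ hκ]
  rcases (norm_nonneg q.1).eq_or_lt with h0 | h0
  · rw [← h0]; simp
  · refine le_of_mul_le_mul_right ?_ h0
    nlinarith

/-- A map bounded below on a complete space has closed range, and `hdense` makes the orthogonal
complement of the range trivial. -/
theorem surjective_of_norm_le {Y : Type*} [NormedAddCommGroup Y] [NormedSpace ℝ Y]
    [CompleteSpace Y] (T : Y →L[ℝ] X) {C : ℝ} (hC : 0 ≤ C) (h : ∀ y, ‖y‖ ≤ C * ‖T y‖)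
    (hdense : ∀ v, (∀ y, inner ℝ (T y) v = 0) → v = 0) : Function.Surjective T := by
  have hanti : AntilipschitzWith C.toNNReal T :=
    T.antilipschitz_of_bound fun y => by rw [Real.coe_toNNReal _ hC]; exact h y
  have hcl : IsClosed (LinearMap.range T.toLinearMap : Set X) := by
    rw [LinearMap.coe_range]
    exact hanti.isClosed_range T.uniformContinuous
  have htop : LinearMap.range T.toLinearMap = ⊤ := by
    rw [← hcl.submodule_topologicalClosure_eq, Submodule.topologicalClosure_eq_top_iff,
      Submodule.eq_bot_iff]
    exact fun v hv => hdense v fun y => (Submodule.mem_orthogonal _ v).1 hv (T y) ⟨_, rfl⟩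
  exact LinearMap.range_eq_top.1 htop

theorem exists_mem_closure_of_coercive (hκ : 0 < κ) (hB : ∀ u, κ * ‖u‖ ^ 2 ≤ inner ℝ (B u) u)
    (hG : ∀ q ∈ G, q.2 q.1 ≤ 0)
    (hdense : ∀ v, (∀ q ∈ G, inner ℝ (B q.1) v = q.2 v) → v = 0) (w : X) :
    ∃ q ∈ closure (G : Set (X × StrongDual ℝ X)), B q.1 - riesz X q.2 = w := by
  let T : G.topologicalClosure →L[ℝ] X :=
    (B.comp (ContinuousLinearMap.fst ℝ X (StrongDual ℝ X)) -
      (riesz X).comp (ContinuousLinearMap.snd ℝ X (StrongDual ℝ X))).comp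
      G.topologicalClosure.subtypeL
  have hT : ∀ q : G.topologicalClosure, T q = B q.1.1 - riesz X q.1.2 := fun q => rfl
  have hκ' : 0 ≤ κ⁻¹ := (inv_pos.2 hκ).le
  have hpos := mul_nonneg (norm_nonneg B) hκ'
  have hsurj : Function.Surjective T := ?_
  · obtain ⟨q, hq⟩ := hsurj w
    exact ⟨q.1, q.2, hq⟩
  -- The constant adds the bounds for the two components: `κ⁻¹` for `u`, and `‖B‖ κ⁻¹ + 1` for `ℓ`,
  -- recovered from `riesz ℓ = B u - T (u, ℓ)`.
  refine surjective_of_norm_le (Y := G.topologicalClosure) T (C := κ⁻¹ + (‖B‖ * κ⁻¹ + 1))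
    (by positivity) (fun q => ?_) (fun v hv => ?_)
  · have h1 := norm_fst_le_of_coercive hκ hB (nonpos_of_mem_closure hG q.2)
    rw [← hT] at h1
    have h2 : ‖q.1.2‖ ≤ (‖B‖ * κ⁻¹ + 1) * ‖T q‖ := by
      rw [← norm_riesz, show riesz X q.1.2 = B q.1.1 - T q by rw [hT]; abel]
      have := B.le_opNorm q.1.1
      have := mul_le_mul_of_nonneg_left h1 (norm_nonneg B)
      have := norm_sub_le (B q.1.1) (T q)
      nlinarith
    have h3 : ‖q‖ = max ‖q.1.1‖ ‖q.1.2‖ := rfl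
    rw [h3, add_mul]
    have := norm_nonneg (T q)
    exact max_le (h1.trans (le_add_of_nonneg_right (by positivity)))
      (h2.trans (le_add_of_nonneg_left (by positivity)))
  · refine hdense v fun q hq => ?_
    have := hv ⟨q, G.le_topologicalClosure hq⟩
    rwa [hT, inner_sub_left, inner_riesz, sub_eq_zero] at this

end Abstract

/-! ### The translation semigroup on `𝓥` -/

variable (c) in
/-- `𝓗 × 𝓗` with its Hilbert space structure. -/
abbrev HH : Type := WithLp 2 (H c × H c)

namespace Admissible

/-- The translation acting on both components of `𝓗 × 𝓗`. -/
def translateHH (hc : Admissible c) (t : ℝ) : HH c →L[ℝ] HH c :=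
  (WithLp.prodContinuousLinearEquiv 2 ℝ (H c) (H c)).symm.toContinuousLinearMap.comp
    (((hc.translate t).comp (WithLp.fstL 2 ℝ (H c) (H c))).prod
      ((hc.translate t).comp (WithLp.sndL 2 ℝ (H c) (H c))))

theorem translateHH_mem_gradGraph (hc : Admissible c) (t : ℝ) {v : HH c} (hv : v ∈ gradGraph c) :
    hc.translateHH t v ∈ gradGraph c := by
  obtain ⟨u, hu, h1, h2⟩ := hv
  refine ⟨u ∘ fwd t, hu.comp_fwd t, ?_, ?_⟩
  · filter_upwards [hc.coeFn_translate t v.fst, hc.ae_fwd t h1] with y e1 e2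
    exact e1.trans e2
  · filter_upwards [hc.coeFn_translate t v.snd, hc.ae_fwd t h2] with y e1 e2
    exact e1.trans e2

theorem translateHH_mem_V (hc : Admissible c) (t : ℝ) {v : HH c} (hv : v ∈ V c) :
    hc.translateHH t v ∈ V c :=
  map_mem_closure (hc.translateHH t).continuous hv fun _ => hc.translateHH_mem_gradGraph t

theorem norm_translateHH_le (hc : Admissible c) (t : ℝ) (v : HH c) :
    ‖hc.translateHH t v‖ ≤ ‖v‖ := by
  rw [← sq_le_sq₀ (norm_nonneg _) (norm_nonneg _), WithLp.prod_norm_sq_eq_of_L2,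
    WithLp.prod_norm_sq_eq_of_L2]
  exact add_le_add (pow_le_pow_left₀ (norm_nonneg _) (hc.norm_translate_le t _) 2)
    (pow_le_pow_left₀ (norm_nonneg _) (hc.norm_translate_le t _) 2)

/-- Test functions have continuous orbits, and contractivity makes their approximation of `v`
uniform in `t`. -/
theorem continuous_translateHH (hc : Admissible c) {v : HH c} (hv : v ∈ V c) :
    Continuous fun t => hc.translateHH t v := by
  refine continuous_of_uniform_approx_of_continuous fun s hs => ?_
  obtain ⟨ε, hε, hs⟩ := Metric.mem_uniformity_dist.1 hs
  obtain ⟨w, hw, hvw⟩ := Metric.mem_closure_iff.1 hv ε hε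
  refine ⟨fun t => hc.translateHH t w, ?_, fun t => hs ?_⟩
  · obtain ⟨u, hu, h1, h2⟩ := hw
    have h2' : w.snd =ᵐ[refMeasure c] fun y => fderiv ℝ u y (0, 1) := by
      refine h2.trans (ae_of_all _ fun y => (hu.hasDerivAt_snd y).deriv)
    exact (WithLp.prod_continuous_toLp 2 _ _).comp
      ((hc.continuous_translate_of_continuous hu.1.continuous hu.2 h1).prodMk
        (hc.continuous_translate_of_continuous (hu.continuous_fderiv _)
          (hu.hasCompactSupport_fderiv _) h2'))
  · rw [dist_eq_norm, ← map_sub]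
    refine (hc.norm_translateHH_le t _).trans_lt ?_
    rwa [← dist_eq_norm]

end Admissible

instance : CompleteSpace (V c) :=
  (Submodule.isClosed_topologicalClosure _).completeSpace_coe

variable (c) in
/-- The embedding `𝓥 → 𝓗` as a continuous linear map. -/
def toHL : V c →L[ℝ] H c := (WithLp.fstL 2 ℝ (H c) (H c)).comp (V c).subtypeL

variable (c) in
/-- The spatial derivative `𝓥 → 𝓗` as a continuous linear map. -/
def dxL : V c →L[ℝ] H c := (WithLp.sndL 2 ℝ (H c) (H c)).comp (V c).subtypeL

theorem toHL_apply (v : V c) : toHL c v = toH c v := rfl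

theorem norm_sq_eq (v : V c) : ‖v‖ ^ 2 = ‖toH c v‖ ^ 2 + ‖dx c v‖ ^ 2 :=
  WithLp.prod_norm_sq_eq_of_L2 _

namespace Admissible

/-- The orbit of `v ∈ 𝓥` under the translation semigroup. -/
def orbit (hc : Admissible c) (v : V c) (t : ℝ) : V c :=
  ⟨hc.translateHH t v, hc.translateHH_mem_V t v.2⟩

theorem continuous_orbit (hc : Admissible c) (v : V c) : Continuous (hc.orbit v) :=
  (hc.continuous_translateHH v.2).subtype_mk _

theorem orbit_zero (hc : Admissible c) (v : V c) : hc.orbit v 0 = v := by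
  ext1
  refine (WithLp.ofLp_injective 2) (Prod.ext ?_ ?_)
  · exact hc.translate_zero _
  · exact hc.translate_zero _

/-- By the semigroup law, `U_t ∫₀ʰ - ∫₀ʰ = ∫_h^{h+t} - ∫₀ᵗ`; dividing by `t` leaves two averages
that converge to the orbit at `h` and at `0`. This supplies enough elements of `D(∂ₜ, 𝓗) ∩ 𝓥` near
any `v ∈ 𝓥`. -/
theorem hasTimeDeriv_integral_orbit (hc : Admissible c) (v : V c) {h : ℝ} (hh : 0 ≤ h) :
    HasTimeDeriv c (toH c (∫ s in (0 : ℝ)..h, hc.orbit v s))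
      (hc.translate h (toH c v) - toH c v) := by
  have hcont : Continuous fun s => hc.translate s (toH c v) :=
    (toHL c).continuous.comp (hc.continuous_orbit v)
  have hint : ∀ a b, IntervalIntegrable (fun s => hc.translate s (toH c v)) volume a b :=
    fun a b => hcont.intervalIntegrable a b
  have h1 : toH c (∫ s in (0 : ℝ)..h, hc.orbit v s) =
      ∫ s in (0 : ℝ)..h, hc.translate s (toH c v) :=
    ((toHL c).intervalIntegral_comp_comm ((hc.continuous_orbit v).intervalIntegrable 0 h)).symm
  rw [h1, hc.hasTimeDeriv_iff]
  have hslope := tendsto_inv_smul_integral hcont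
  have h0 := hslope 0
  rw [hc.translate_zero] at h0
  refine ((hslope h).sub h0).congr' ?_
  filter_upwards [self_mem_nhdsWithin] with t ht
  have ht : (0 : ℝ) < t := ht
  have h2 : hc.translate t (∫ s in (0 : ℝ)..h, hc.translate s (toH c v)) =
      ∫ s in t..(h + t), hc.translate s (toH c v) := by
    rw [← (hc.translate t).intervalIntegral_comp_comm (hint 0 h)]
    have : ∀ s ∈ uIcc 0 h, hc.translate t (hc.translate s (toH c v)) =
        hc.translate (s + t) (toH c v) := fun s hs => by
      rw [uIcc_of_le hh] at hs
      exact hc.translate_translate ht.le hs.1 _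
    rw [intervalIntegral.integral_congr this,
      intervalIntegral.integral_comp_add_right (fun s => hc.translate s (toH c v)), zero_add]
  rw [h2, ← smul_sub, zero_add]
  congr 1
  rw [sub_eq_sub_iff_add_eq_add, add_comm,
    intervalIntegral.integral_add_adjacent_intervals (hint _ _) (hint _ _),
    add_comm (∫ s in t..h + t, _),
    intervalIntegral.integral_add_adjacent_intervals (hint _ _) (hint _ _)]

end Admissible

/-! ### Existence and uniqueness of the resolvent -/

/-- The operator of the form `a (L ·, L ·) + b (M ·, M ·)` on a Hilbert space. -/
def gramOp {X Y : Type*} [NormedAddCommGroup X] [InnerProductSpace ℝ X] [CompleteSpace X]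
    [NormedAddCommGroup Y] [InnerProductSpace ℝ Y] [CompleteSpace Y] (a b : ℝ) (L M : X →L[ℝ] Y) :
    X →L[ℝ] X :=
  a • (ContinuousLinearMap.adjoint L).comp L + b • (ContinuousLinearMap.adjoint M).comp M

theorem inner_gramOp {X Y : Type*} [NormedAddCommGroup X] [InnerProductSpace ℝ X]
    [CompleteSpace X] [NormedAddCommGroup Y] [InnerProductSpace ℝ Y] [CompleteSpace Y] (a b : ℝ)
    (L M : X →L[ℝ] Y) (u v : X) :
    inner ℝ (gramOp a b L M u) v = a * inner ℝ (L u) (L v) + b * inner ℝ (M u) (M v) := by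
  simp only [gramOp, add_apply, smul_apply,
    ContinuousLinearMap.comp_apply, inner_add_left, real_inner_smul_left,
    ContinuousLinearMap.adjoint_inner_left]

variable (c) in
/-- The operator on `𝓥` representing `𝓐 + α (·, ·)`. -/
def formOp (α : ℝ) : V c →L[ℝ] V c :=
  gramOp (c.sigma ^ 2 / 8) α (dxL c) (toHL c)

theorem inner_formOp (α : ℝ) (u v : V c) :
    inner ℝ (formOp c α u) v = formA c u v + α * inner ℝ (toH c u) (toH c v) :=
  inner_gramOp _ _ _ _ _ _

theorem formOp_coercive {α : ℝ} (u : V c) :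
    min (c.sigma ^ 2 / 8) α * ‖u‖ ^ 2 ≤ inner ℝ (formOp c α u) u := by
  rw [inner_formOp, formA, real_inner_self_eq_norm_sq, real_inner_self_eq_norm_sq, norm_sq_eq,
    mul_add, add_comm]
  gcongr
  · exact min_le_left _ _
  · exact min_le_right _ _

theorem formE_eq (α : ℝ) (q : V c × StrongDual ℝ (V c)) (v : V c) :
    formE c α q.1 q.2 v = inner ℝ (formOp c α q.1 - riesz (V c) q.2) v := by
  rw [inner_sub_left, inner_riesz, inner_formOp, formE]
  ring

namespace Admissible

/-- The graph of `∂ₜ` on `D(∂ₜ, 𝓗) ∩ 𝓥` as a subspace of `𝓥 × 𝓥'`. -/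
def timeCore (hc : Admissible c) : Submodule ℝ (V c × StrongDual ℝ (V c)) where
  carrier := {q | ∃ K : H c, HasTimeDeriv c (toH c q.1) K ∧
    ∀ w : V c, q.2 w = inner ℝ K (toH c w)}
  zero_mem' := by
    refine ⟨0, ?_, fun w => by simp⟩
    rw [hc.hasTimeDeriv_iff]
    have : toH c (0 : V c) = 0 := rfl
    simp [this]
  add_mem' := by
    rintro q r ⟨K, h1, h2⟩ ⟨L, h3, h4⟩
    refine ⟨K + L, ?_, fun w => ?_⟩
    · rw [hc.hasTimeDeriv_iff] at h1 h3 ⊢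
      refine (h1.add h3).congr fun t => ?_
      have : toH c (q + r).1 = toH c q.1 + toH c r.1 := rfl
      rw [this, map_add, ← smul_add]
      congr 1
      abel
    · rw [inner_add_left, ← h2, ← h4]
      rfl
  smul_mem' := by
    rintro a q ⟨K, h1, h2⟩
    refine ⟨a • K, ?_, fun w => ?_⟩
    · rw [hc.hasTimeDeriv_iff] at h1 ⊢
      refine (h1.const_smul a).congr fun t => ?_
      have : toH c (a • q).1 = a • toH c q.1 := rfl
      rw [this, map_smul, ← smul_sub, smul_comm]
    · rw [real_inner_smul_left, ← h2]
      rfl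

theorem timeCore_nonpos (hc : Admissible c) {q : V c × StrongDual ℝ (V c)}
    (hq : q ∈ hc.timeCore) : q.2 q.1 ≤ 0 := by
  obtain ⟨K, hK, h⟩ := hq
  rw [h]
  rw [hc.hasTimeDeriv_iff] at hK
  refine le_of_tendsto (hK.inner tendsto_const_nhds) ?_
  filter_upwards [self_mem_nhdsWithin] with t ht
  rw [real_inner_smul_left]
  exact mul_nonpos_of_nonneg_of_nonpos (inv_pos.2 ht).le (hc.inner_translate_sub_le t _)

/-- Testing with `∫₀ʰ U_s v ds` turns the right-hand side into `(U_h v - v, v) ≤ 0`. After division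
by `h`, the limit `h ↓ 0` contradicts coercivity unless `v = 0`. -/
theorem eq_zero_of_formOp_eq (hc : Admissible c) {α : ℝ} (hα : 0 < α) (v : V c)
    (hv : ∀ q ∈ hc.timeCore, inner ℝ (formOp c α q.1) v = q.2 v) : v = 0 := by
  have hκ : 0 < min (c.sigma ^ 2 / 8) α :=
    lt_min (div_pos (pow_pos hc.sigma_pos 2) (by norm_num)) hα
  have h1 : ∀ h : ℝ, 0 ≤ h →
      inner ℝ (formOp c α (∫ s in (0 : ℝ)..h, hc.orbit v s)) v ≤ 0 := fun h hh => by
    have := hv (∫ s in (0 : ℝ)..h, hc.orbit v s,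
      (innerSL ℝ (hc.translate h (toH c v) - toH c v)).comp (toHL c))
      ⟨_, hc.hasTimeDeriv_integral_orbit v hh, fun w => rfl⟩
    rw [this]
    exact hc.inner_translate_sub_le h (toH c v)
  have h2 : Tendsto (fun t : ℝ => t⁻¹ • ∫ s in (0 : ℝ)..t, hc.orbit v s) (𝓝[>] 0) (𝓝 v) := by
    have := tendsto_inv_smul_integral (hc.continuous_orbit v) 0
    simpa only [hc.orbit_zero, zero_add] using this
  have h3 : inner ℝ (formOp c α v) v ≤ 0 := by
    refine le_of_tendsto ((((formOp c α).continuous.tendsto v).comp h2).inner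
      tendsto_const_nhds) ?_
    filter_upwards [self_mem_nhdsWithin] with t ht
    rw [Function.comp_apply, map_smul]
    exact (real_inner_smul_left _ _ _).trans_le
      (mul_nonpos_of_nonneg_of_nonpos (inv_pos.2 ht).le (h1 t (le_of_lt ht)))
  have h4 := (formOp_coercive v).trans h3
  have h5 : ‖v‖ ^ 2 ≤ 0 := by
    by_contra h
    exact absurd h4 (not_le.2 (mul_pos hκ (not_le.1 h)))
  exact norm_eq_zero.1 (pow_eq_zero_iff two_ne_zero |>.1 (le_antisymm h5 (sq_nonneg _)))

theorem exists_isResolvent (hc : Admissible c) {α : ℝ} (hα : 0 < α) (f : H c) :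
    ∃ g, IsResolvent c α f g := by
  have hκ : 0 < min (c.sigma ^ 2 / 8) α :=
    lt_min (div_pos (pow_pos hc.sigma_pos 2) (by norm_num)) hα
  -- The adjoint of the embedding sends `f` to the Riesz representative in `𝓥` of `v ↦ (f, v)_𝓗`.
  obtain ⟨q, hq, h⟩ := exists_mem_closure_of_coercive hκ formOp_coercive
    (fun _ => hc.timeCore_nonpos) (hc.eq_zero_of_formOp_eq hα)
    (ContinuousLinearMap.adjoint (toHL c) f)
  refine ⟨_, q, hq, rfl, fun v => ?_⟩
  rw [formE_eq, h, ContinuousLinearMap.adjoint_inner_left, toHL_apply]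

end Admissible

theorem Admissible.isResolvent_sub (hc : Admissible c) {α : ℝ} {f f' g g' : H c}
    (h : IsResolvent c α f g) (h' : IsResolvent c α f' g') :
    IsResolvent c α (f - f') (g - g') := by
  obtain ⟨q, hq, rfl, hqf⟩ := h
  obtain ⟨q', hq', rfl, hqf'⟩ := h'
  -- `timeGraph` is by definition the closure of the carrier of `timeCore`, hence a linear subspace.
  refine ⟨q - q', hc.timeCore.topologicalClosure.sub_mem hq hq', rfl, fun v => ?_⟩
  rw [inner_sub_left, ← hqf, ← hqf', formE_eq, formE_eq, formE_eq, ← inner_sub_left,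
    Prod.fst_sub, Prod.snd_sub, map_sub, map_sub]
  congr 1
  abel

theorem Admissible.isResolvent_smul (hc : Admissible c) {α : ℝ} {f g : H c} (r : ℝ)
    (h : IsResolvent c α f g) : IsResolvent c α (r • f) (r • g) := by
  obtain ⟨q, hq, rfl, hqf⟩ := h
  refine ⟨r • q, hc.timeCore.topologicalClosure.smul_mem r hq, rfl, fun v => ?_⟩
  rw [real_inner_smul_left, ← hqf, formE_eq, formE_eq, ← real_inner_smul_left,
    Prod.smul_fst, Prod.smul_snd, map_smul, map_smul, smul_sub]

/-- Testing with `g` itself and dropping `𝓐(g, g) ≥ 0` and `-⟨∂ₜg, g⟩ ≥ 0` leaves `α‖g‖² ≤ (f, g)`.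
Uniqueness and continuity of `G_α` both come from this. -/
theorem Admissible.norm_le_of_isResolvent (hc : Admissible c) {α : ℝ} {f g : H c} (hα : 0 < α)
    (h : IsResolvent c α f g) : ‖g‖ ≤ α⁻¹ * ‖f‖ := by
  obtain ⟨q, hq, rfl, hqf⟩ := h
  have h1 := hqf q.1
  have h2 := nonpos_of_mem_closure (fun _ => hc.timeCore_nonpos) hq
  have h3 := real_inner_le_norm f (toH c q.1)
  rw [formE, formA, real_inner_self_eq_norm_sq, real_inner_self_eq_norm_sq] at h1
  have h4 : 0 ≤ c.sigma ^ 2 / 8 * ‖dx c q.1‖ ^ 2 := by positivity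
  rw [le_inv_mul_iff₀ hα]
  rcases (norm_nonneg (toH c q.1)).eq_or_lt with h0 | h0
  · rw [← h0, mul_zero]; exact norm_nonneg f
  · refine le_of_mul_le_mul_right ?_ h0
    nlinarith

namespace Admissible

theorem isResolvent_unique (hc : Admissible c) {α : ℝ} {f g g' : H c} (hα : 0 < α)
    (h : IsResolvent c α f g) (h' : IsResolvent c α f g') : g = g' := by
  have := hc.norm_le_of_isResolvent hα (hc.isResolvent_sub h h')
  rw [sub_self, norm_zero, mul_zero] at this
  exact sub_eq_zero.1 (norm_le_zero_iff.1 this)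

theorem existsUnique_isResolvent (hc : Admissible c) {α : ℝ} (hα : 0 < α) (f : H c) :
    ∃! g, IsResolvent c α f g :=
  existsUnique_of_exists_of_unique (hc.exists_isResolvent hα f)
    fun _ _ => hc.isResolvent_unique hα

theorem isResolvent_resolvent (hc : Admissible c) {α : ℝ} (hα : 0 < α) (f : H c) :
    IsResolvent c α f (resolvent c α f) :=
  Classical.epsilon_spec (hc.exists_isResolvent hα f)

theorem norm_resolvent_sub_le (hc : Admissible c) {α : ℝ} (hα : 0 < α) (f g : H c) :
    ‖resolvent c α f - resolvent c α g‖ ≤ α⁻¹ * ‖f - g‖ :=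
  hc.norm_le_of_isResolvent hα
    (hc.isResolvent_sub (hc.isResolvent_resolvent hα f) (hc.isResolvent_resolvent hα g))

end Admissible

/-! ### Primitives of cut-off functions -/

/-- A continuous function with values in `[0, 1]`. -/
structure IsGate (g : ℝ → ℝ) : Prop where
  continuous : Continuous g
  nonneg : ∀ r, 0 ≤ g r
  le_one : ∀ r, g r ≤ 1

/-- The primitive of `g` that vanishes at `0`. -/
def prim (g : ℝ → ℝ) (r : ℝ) : ℝ := ∫ s in (0 : ℝ)..r, g s

theorem prim_zero (g : ℝ → ℝ) : prim g 0 = 0 := intervalIntegral.integral_same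

theorem hasDerivAt_prim {g : ℝ → ℝ} (hg : Continuous g) (r : ℝ) :
    HasDerivAt (prim g) (g r) r :=
  intervalIntegral.integral_hasDerivAt_right (hg.intervalIntegrable 0 r)
    (hg.stronglyMeasurableAtFilter _ _) hg.continuousAt

namespace IsGate

variable {g : ℝ → ℝ}

theorem lipschitzWith (hg : IsGate g) : LipschitzWith 1 (prim g) := by
  refine lipschitzWith_of_nnnorm_deriv_le
    (fun r => (hasDerivAt_prim hg.continuous r).differentiableAt) fun r => ?_
  rw [(hasDerivAt_prim hg.continuous r).deriv, ← NNReal.coe_le_coe, coe_nnnorm, Real.norm_eq_abs,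
    abs_of_nonneg (hg.nonneg r)]
  exact hg.le_one r

theorem continuous_prim (hg : IsGate g) : Continuous (prim g) := hg.lipschitzWith.continuous

/-- A continuous gate, in place of an indicator function, makes the truncation `C¹`, so composing it
with a test function gives a test function. -/
theorem contDiff_prim (hg : IsGate g) : ContDiff ℝ 1 (prim g) := by
  rw [contDiff_one_iff_deriv]
  refine ⟨fun r => (hasDerivAt_prim hg.continuous r).differentiableAt, ?_⟩
  rw [funext fun r => (hasDerivAt_prim hg.continuous r).deriv]
  exact hg.continuous

theorem monotone_prim (hg : IsGate g) : Monotone (prim g) :=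
  monotone_of_deriv_nonneg (fun r => (hasDerivAt_prim hg.continuous r).differentiableAt) fun r => by
    rw [(hasDerivAt_prim hg.continuous r).deriv]
    exact hg.nonneg r

/-- The tangent-line inequality for `Φ = prim (prim g)`, which is convex because `prim g` is
increasing. -/
theorem prim_mul_sub_le (hg : IsGate g) (a b : ℝ) :
    prim g a * (b - a) ≤ prim (prim g) b - prim (prim g) a := by
  have hi : ∀ a b, IntervalIntegrable (prim g) volume a b :=
    fun a b => hg.continuous_prim.intervalIntegrable a b
  have h1 : prim (prim g) b - prim (prim g) a = ∫ s in a..b, prim g s :=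
    intervalIntegral.integral_interval_sub_left (hi _ _) (hi _ _)
  rw [h1, mul_comm]
  rcases le_total a b with h | h
  · have := intervalIntegral.integral_mono_on (f := fun _ => prim g a) h
      (by simp) (hi a b) fun s hs => hg.monotone_prim hs.1
    simpa using this
  · have := intervalIntegral.integral_mono_on (g := fun _ => prim g a) h
      (hi b a) (by simp) fun s hs => hg.monotone_prim hs.2
    rw [intervalIntegral.integral_symm]
    simp only [intervalIntegral.integral_const, smul_eq_mul] at this
    linarith

theorem prim_prim_nonneg (hg : IsGate g) (r : ℝ) : 0 ≤ prim (prim g) r := by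
  simpa [prim_zero] using hg.prim_mul_sub_le 0 r

theorem abs_prim_le (hg : IsGate g) (r : ℝ) : |prim g r| ≤ |r| := by
  simpa [Real.dist_eq, prim_zero] using hg.lipschitzWith.dist_le_mul r 0

theorem prim_prim_le (hg : IsGate g) (r : ℝ) : prim (prim g) r ≤ r * r := by
  have h1 := hg.prim_mul_sub_le r 0
  rw [prim_zero, zero_sub, zero_sub] at h1
  have h2 := le_abs_self (prim g r * r)
  rw [abs_mul] at h2
  have h3 := mul_le_mul_of_nonneg_right (hg.abs_prim_le r) (abs_nonneg r)
  have h4 := abs_mul_abs_self r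
  linarith

end IsGate

theorem Admissible.integrable_comp_fwd (hc : Admissible c) (t : ℝ) {F : ℝ × ℝ → ℝ}
    (hF : Integrable F (refMeasure c)) : Integrable (fun y => F (fwd t y)) (refMeasure c) :=
  memLp_one_iff_integrable.1 (hc.memLp_comp_fwd t (memLp_one_iff_integrable.2 hF))

/-! ### Composition with primitives on `𝓗` and `𝓥` -/

theorem inner_eq_integral (F G : H c) : inner ℝ F G = ∫ y, F y * G y ∂refMeasure c := by
  rw [L2.inner_def]
  refine integral_congr_ae (ae_of_all _ fun y => ?_)
  simp [mul_comm]

theorem integrable_mul (F G : H c) : Integrable (fun y => F y * G y) (refMeasure c) :=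
  (L2.integrable_inner (𝕜 := ℝ) F G).congr (ae_of_all _ fun y => by simp [mul_comm])

namespace IsGate

variable {g : ℝ → ℝ}

/-- `F ↦ φ ∘ F` on `𝓗`, where `φ` is the primitive of `g`. -/
def compH (hg : IsGate g) (F : H c) : H c := hg.lipschitzWith.compLp (prim_zero g) F

theorem coeFn_compH (hg : IsGate g) (F : H c) :
    hg.compH F =ᵐ[refMeasure c] fun y => prim g (F y) :=
  hg.lipschitzWith.coeFn_compLp (prim_zero g) F

theorem memLp_mul (hg : IsGate g) (F K : H c) :
    MemLp (fun y => g (F y) * K y) 2 (refMeasure c) := by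
  refine (Lp.memLp K).of_le ((hg.continuous.comp_aestronglyMeasurable
    (Lp.aestronglyMeasurable F)).mul (Lp.aestronglyMeasurable K)) (ae_of_all _ fun y => ?_)
  rw [norm_mul, Real.norm_eq_abs, abs_of_nonneg (hg.nonneg _)]
  exact mul_le_of_le_one_left (norm_nonneg _) (hg.le_one _)

/-- The product `g(F) K`. -/
def mulH (hg : IsGate g) (F K : H c) : H c := (hg.memLp_mul F K).toLp _

theorem coeFn_mulH (hg : IsGate g) (F K : H c) :
    hg.mulH F K =ᵐ[refMeasure c] fun y => g (F y) * K y :=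
  MemLp.coeFn_toLp (hg.memLp_mul F K)

theorem mulH_add (hg : IsGate g) (F K L : H c) : hg.mulH F (K + L) = hg.mulH F K + hg.mulH F L := by
  ext1
  filter_upwards [hg.coeFn_mulH F (K + L), hg.coeFn_mulH F K, hg.coeFn_mulH F L,
    Lp.coeFn_add K L, Lp.coeFn_add (hg.mulH F K) (hg.mulH F L)] with y h1 h2 h3 h4 h5
  rw [h1, h5, Pi.add_apply, h2, h3, h4, Pi.add_apply, mul_add]

theorem norm_mulH_le (hg : IsGate g) (F K : H c) : ‖hg.mulH F K‖ ≤ ‖K‖ := by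
  refine Lp.norm_le_norm_of_ae_le ?_
  filter_upwards [hg.coeFn_mulH F K] with y hy
  rw [hy, norm_mul, Real.norm_eq_abs, abs_of_nonneg (hg.nonneg _)]
  exact mul_le_of_le_one_left (norm_nonneg _) (hg.le_one _)

/-- Varying `K` costs at most its norm since `0 ≤ g ≤ 1`. For fixed `K`, every subsequence of `F_n →
F` has a further one converging a.e., and `|K|` dominates. -/
theorem continuous_mulH (hg : IsGate g) :
    Continuous fun q : H c × H c => hg.mulH q.1 q.2 := by
  rw [continuous_iff_seqContinuous]
  intro x q hx
  have hx1 : Tendsto (fun n => (x n).1) atTop (𝓝 q.1) := (continuous_fst.tendsto q).comp hx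
  have hx2 : Tendsto (fun n => (x n).2) atTop (𝓝 q.2) := (continuous_snd.tendsto q).comp hx
  have h1 : Tendsto (fun n => hg.mulH (x n).1 ((x n).2 - q.2)) atTop (𝓝 0) := by
    rw [tendsto_zero_iff_norm_tendsto_zero]
    exact squeeze_zero (fun _ => norm_nonneg _) (fun n => hg.norm_mulH_le _ _)
      (tendsto_iff_norm_sub_tendsto_zero.1 hx2)
  have h2 : Tendsto (fun n => hg.mulH (x n).1 q.2) atTop (𝓝 (hg.mulH q.1 q.2)) := by
    refine tendsto_of_subseq_tendsto fun ns hns => ?_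
    obtain ⟨ms, -, hms⟩ := (tendstoInMeasure_of_tendsto_Lp (hx1.comp hns)).exists_seq_tendsto_ae
    refine ⟨ms, tendsto_Lp_of_dominated (G := fun y => |q.2 y|) (Lp.memLp q.2).abs
      (fun n => hg.coeFn_mulH (x (ns (ms n))).1 q.2) (hg.coeFn_mulH q.1 q.2) ?_ ?_⟩
    · refine Eventually.of_forall fun n => ae_of_all _ fun y => ?_
      rw [← sub_mul, abs_mul]
      refine mul_le_of_le_one_left (abs_nonneg _) (abs_sub_le_iff.2 ⟨?_, ?_⟩)
      · linarith [hg.le_one ((x (ns (ms n))).1 y), hg.nonneg (q.1 y)]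
      · linarith [hg.nonneg ((x (ns (ms n))).1 y), hg.le_one (q.1 y)]
    · filter_upwards [hms] with y hy
      exact ((hg.continuous.tendsto _).comp hy).mul_const _
  have h3 := h1.add h2
  rw [zero_add] at h3
  refine h3.congr fun n => ?_
  rw [← hg.mulH_add, sub_add_cancel]
  rfl

/-- `(F, K) ↦ (φ(F), g(F) K)`, where `φ` is the primitive of `g`. -/
def compHH (hg : IsGate g) (v : HH c) : HH c :=
  WithLp.toLp 2 (hg.compH v.fst, hg.mulH v.fst v.snd)

theorem continuous_compHH (hg : IsGate g) : Continuous (hg.compHH : HH c → HH c) :=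
  (WithLp.prod_continuous_toLp 2 _ _).comp
    (((hg.lipschitzWith.continuous_compLp (prim_zero g)).comp (WithLp.continuous_fst 2 _ _)).prodMk
      (hg.continuous_mulH.comp (WithLp.prod_continuous_ofLp 2 _ _)))

/-- The chain rule holds on test functions, and continuity of `compHH` carries it to the closure. -/
theorem compHH_mem_V (hg : IsGate g) {v : HH c} (hv : v ∈ V c) : hg.compHH v ∈ V c := by
  refine map_mem_closure hg.continuous_compHH hv ?_
  rintro w ⟨u, hu, h1, h2⟩
  refine ⟨prim g ∘ u, ⟨hg.contDiff_prim.comp hu.1, hu.2.comp_left (prim_zero g)⟩, ?_, ?_⟩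
  · filter_upwards [hg.coeFn_compH w.fst, h1] with y e1 e2
    exact e1.trans (by rw [e2]; rfl)
  · filter_upwards [hg.coeFn_mulH w.fst w.snd, h1, h2] with y e1 e2 e3
    refine e1.trans ?_
    rw [e2, e3, (hu.hasDerivAt_snd y).deriv]
    exact ((hasDerivAt_prim hg.continuous (u y)).comp y.2 (hu.hasDerivAt_snd y)).deriv.symm

/-- `u ↦ φ(u)` on `𝓥`, where `φ` is the primitive of `g`. -/
def compV (hg : IsGate g) (v : V c) : V c := ⟨hg.compHH v, hg.compHH_mem_V v.2⟩

theorem continuous_compV (hg : IsGate g) : Continuous (hg.compV : V c → V c) :=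
  (hg.continuous_compHH.comp continuous_subtype_val).subtype_mk _

theorem inner_mulH_nonneg (hg : IsGate g) (F K : H c) : 0 ≤ inner ℝ K (hg.mulH F K) := by
  rw [inner_eq_integral]
  refine integral_nonneg_of_ae ?_
  filter_upwards [hg.coeFn_mulH F K] with y hy
  rw [hy, Pi.zero_apply, mul_left_comm]
  exact mul_nonneg (hg.nonneg _) (mul_self_nonneg _)

theorem integrable_prim_prim (hg : IsGate g) (F : H c) :
    Integrable (fun y => prim (prim g) (F y)) (refMeasure c) := by
  refine (integrable_mul F F).mono' ?_ (ae_of_all _ fun y => ?_)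
  · have : Continuous (prim (prim g)) := continuous_iff_continuousAt.2 fun r =>
      (hasDerivAt_prim hg.continuous_prim r).continuousAt
    exact this.comp_aestronglyMeasurable (Lp.aestronglyMeasurable F)
  · rw [Real.norm_eq_abs, abs_of_nonneg (hg.prim_prim_nonneg _)]
    exact hg.prim_prim_le _

/-- Convexity gives `(U_tF - F) φ(F) ≤ Φ(U_tF) - Φ(F)` pointwise, and the integral of `Φ(U_tF)` is
at most that of `Φ(F)` because translation decreases `m`. -/
theorem inner_translate_sub_compH_nonpos (hg : IsGate g) (hc : Admissible c) (t : ℝ) (F : H c) :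
    inner ℝ (hc.translate t F - F) (hg.compH F) ≤ 0 := by
  have hΦ := hg.integrable_prim_prim F
  have hΦt := hc.integrable_comp_fwd t hΦ
  have h1 := hc.integral_comp_fwd_le t hΦ fun y => hg.prim_prim_nonneg _
  have h2 : ∫ y, (hc.translate t F - F : H c) y * hg.compH F y ∂refMeasure c ≤
      ∫ y, (prim (prim g) (F (fwd t y)) - prim (prim g) (F y)) ∂refMeasure c := by
    refine integral_mono_ae (integrable_mul _ _) (hΦt.sub hΦ) ?_
    filter_upwards [hc.coeFn_translate t F, Lp.coeFn_sub (hc.translate t F) F,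
      hg.coeFn_compH F] with y h1 h2 h3
    rw [h2, h3, Pi.sub_apply, h1, mul_comm]
    exact hg.prim_mul_sub_le (F y) (F (fwd t y))
  rw [integral_sub hΦt hΦ] at h2
  rw [inner_eq_integral]
  exact h2.trans (sub_nonpos.2 h1)

/-- On the core this is the limit of the translation inequality divided by `t`. Passing to the
closure needs `u ↦ φ(u)` continuous in the norm of `𝓥`, since `ℓ` is only in `𝓥'`. -/
theorem timeGraph_compV_nonpos (hg : IsGate g) (hc : Admissible c)
    {q : V c × StrongDual ℝ (V c)} (hq : q ∈ timeGraph c) : q.2 (hg.compV q.1) ≤ 0 := by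
  have hcl : IsClosed {q : V c × StrongDual ℝ (V c) | q.2 (hg.compV q.1) ≤ 0} :=
    isClosed_le (continuous_snd.clm_apply (hg.continuous_compV.comp continuous_fst))
      continuous_const
  refine closure_minimal ?_ hcl hq
  rintro q ⟨K, hK, h⟩
  rw [hc.hasTimeDeriv_iff] at hK
  change q.2 (hg.compV q.1) ≤ 0
  rw [h]
  refine le_of_tendsto (hK.inner tendsto_const_nhds) ?_
  filter_upwards [self_mem_nhdsWithin] with t ht
  rw [real_inner_smul_left]
  exact mul_nonpos_of_nonneg_of_nonpos (inv_pos.2 ht).le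
    (hg.inner_translate_sub_compH_nonpos hc t _)

/-- The resolvent equation is tested with `φ(F)`; here `𝓐(F, φ(F)) = (σ²/8) ∫ g(F) |∂ₓF|² dm ≥ 0`.
-/
theorem inner_sub_compH_nonpos (hg : IsGate g) (hc : Admissible c) {α : ℝ} {f F : H c}
    (h : IsResolvent c α f F) : inner ℝ (α • F - f) (hg.compH F) ≤ 0 := by
  obtain ⟨q, hq, rfl, hqf⟩ := h
  have h1 : formE c α q.1 q.2 (hg.compV q.1) = inner ℝ f (hg.compH (toH c q.1)) := hqf _
  have h2 := hg.timeGraph_compV_nonpos hc hq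
  have h3 : 0 ≤ formA c q.1 (hg.compV q.1) :=
    mul_nonneg (by positivity) (hg.inner_mulH_nonneg (toH c q.1) (dx c q.1))
  have h4 : toH c (hg.compV q.1) = hg.compH (toH c q.1) := rfl
  rw [formE, h4] at h1
  rw [inner_sub_left, real_inner_smul_left]
  linarith

/-- If `φ` vanishes on `P` and `(αF - f) φ(F)` is positive wherever `P` fails for `F`, then `P`
holds for `F` almost everywhere. -/
theorem ae_of_isResolvent (hg : IsGate g) (hc : Admissible c) {α : ℝ} {f F : H c}
    (h : IsResolvent c α f F) {P : ℝ → Prop} (h0 : ∀ r, P r → prim g r = 0)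
    (hpos : ∀ᵐ y ∂refMeasure c, ¬ P (F y) → 0 < (α * F y - f y) * prim g (F y)) :
    ∀ᵐ y ∂refMeasure c, P (F y) := by
  have h1 := hg.inner_sub_compH_nonpos hc h
  rw [inner_eq_integral] at h1
  have h2 : ∀ᵐ y ∂refMeasure c, (α • F - f : H c) y * hg.compH F y =
      (α * F y - f y) * prim g (F y) := by
    filter_upwards [Lp.coeFn_sub (α • F) f, Lp.coeFn_smul α F, hg.coeFn_compH F] with y e1 e2 e3
    rw [e1, e3, Pi.sub_apply, e2, Pi.smul_apply, smul_eq_mul]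
  have h3 : 0 ≤ᵐ[refMeasure c] fun y => (α • F - f : H c) y * hg.compH F y := by
    filter_upwards [h2, hpos] with y e1 e2
    rw [e1]
    by_cases hP : P (F y)
    · rw [h0 _ hP, mul_zero]; rfl
    · exact (e2 hP).le
  -- A nonnegative integrand with nonpositive integral vanishes almost everywhere.
  have h4 := (integral_eq_zero_iff_of_nonneg_ae h3 (integrable_mul _ _)).1
    (le_antisymm h1 (integral_nonneg_of_ae h3))
  filter_upwards [h2, hpos, h4] with y e1 e2 e3
  by_contra hP
  rw [e1] at e3
  exact (e2 hP).ne' e3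

end IsGate

theorem isGate_max_min (φ : ℝ → ℝ) (hφ : Continuous φ) : IsGate fun r => max 0 (min 1 (φ r)) :=
  ⟨by fun_prop, fun _ => le_max_left _ _, fun _ => max_le zero_le_one (min_le_left _ _)⟩

/-! ### The resolvent is positivity preserving and sub-Markovian -/

namespace Admissible

theorem nonneg_of_isResolvent (hc : Admissible c) {α : ℝ} (hα : 0 < α) {f F : H c}
    (h : IsResolvent c α f F) (hf : ∀ᵐ y ∂refMeasure c, 0 ≤ f y) :
    ∀ᵐ y ∂refMeasure c, 0 ≤ F y := by
  -- The primitive of this gate vanishes for `r ≥ 0` and is negative for `r < 0`; where `F < 0 ≤ f`,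
  -- both factors in `ae_of_isResolvent` are negative.
  have hg := isGate_max_min (fun r => -r) continuous_neg
  refine hg.ae_of_isResolvent hc h (P := fun r => 0 ≤ r) (fun r hr => ?_) ?_
  · unfold prim
    refine intervalIntegral.integral_zero_ae (ae_of_all _ fun s hs => ?_)
    rw [uIoc_of_le hr] at hs
    exact max_eq_left ((min_le_right _ _).trans (neg_nonpos.2 hs.1.le))
  · filter_upwards [hf] with y hy hF
    rw [not_le] at hF
    refine mul_pos_of_neg_of_neg (by nlinarith) ?_
    unfold prim
    rw [intervalIntegral.integral_symm, neg_lt_zero]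
    refine intervalIntegral.intervalIntegral_pos_of_pos_on
      (hg.continuous.intervalIntegrable _ _) (fun s hs => ?_) hF
    exact lt_max_of_lt_right (lt_min zero_lt_one (neg_pos.2 hs.2))

theorem le_of_isResolvent (hc : Admissible c) {α : ℝ} (hα : 0 < α) {f F : H c}
    (h : IsResolvent c α f F) (hf : ∀ᵐ y ∂refMeasure c, f y ≤ 1) :
    ∀ᵐ y ∂refMeasure c, F y ≤ α⁻¹ := by
  -- This gate opens only above `α⁻¹`, where `αF > 1 ≥ f`.
  have hg := isGate_max_min (fun r => r - α⁻¹) (by fun_prop)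
  have hα' := inv_pos.2 hα
  have hint : ∀ a b, IntervalIntegrable (fun r => max 0 (min 1 (r - α⁻¹))) volume a b :=
    fun a b => hg.continuous.intervalIntegrable a b
  have hzero : ∀ r, r ≤ α⁻¹ → prim (fun r => max 0 (min 1 (r - α⁻¹))) r = 0 := fun r hr => by
    unfold prim
    refine intervalIntegral.integral_zero_ae (ae_of_all _ fun s hs => ?_)
    have hs' : s ≤ α⁻¹ := hs.2.trans (max_le hα'.le hr)
    exact max_eq_left ((min_le_right _ _).trans (sub_nonpos.2 hs'))
  refine hg.ae_of_isResolvent hc h (P := fun r => r ≤ α⁻¹) hzero ?_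
  filter_upwards [hf] with y hy hF
  rw [not_le] at hF
  refine mul_pos ?_ ?_
  · have := mul_lt_mul_of_pos_left hF hα
    rw [mul_inv_cancel₀ hα.ne'] at this
    linarith
  · have h1 := hzero α⁻¹ le_rfl
    unfold prim at h1 ⊢
    rw [← intervalIntegral.integral_add_adjacent_intervals (hint 0 α⁻¹) (hint _ _), h1, zero_add]
    refine intervalIntegral.intervalIntegral_pos_of_pos_on (hint _ _) (fun s hs => ?_) hF
    exact lt_max_of_lt_right (lt_min zero_lt_one (sub_pos.2 hs.1))

theorem mono_of_isResolvent (hc : Admissible c) {α : ℝ} (hα : 0 < α) {f f' F F' : H c}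
    (h : IsResolvent c α f F) (h' : IsResolvent c α f' F')
    (hf : ∀ᵐ y ∂refMeasure c, f y ≤ f' y) : ∀ᵐ y ∂refMeasure c, F y ≤ F' y := by
  have := hc.nonneg_of_isResolvent hα (hc.isResolvent_sub h' h) (by
    filter_upwards [hf, Lp.coeFn_sub f' f] with y h1 h2
    rw [h2, Pi.sub_apply]
    exact sub_nonneg.2 h1)
  filter_upwards [this, Lp.coeFn_sub F' F] with y h1 h2
  rw [h2, Pi.sub_apply] at h1
  exact sub_nonneg.1 h1

theorem isSubMarkovian (hc : Admissible c) {α : ℝ} (hα : 0 < α) :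
    IsSubMarkovian c fun f => α • resolvent c α f := by
  intro f hf
  have h := hc.isResolvent_resolvent hα f
  filter_upwards [hc.nonneg_of_isResolvent hα h (hf.mono fun _ h => h.1),
    hc.le_of_isResolvent hα h (hf.mono fun _ h => h.2),
    Lp.coeFn_smul α (resolvent c α f)] with y h1 h2 h3
  rw [h3, Pi.smul_apply, smul_eq_mul]
  exact ⟨mul_nonneg hα.le h1, by rwa [← le_inv_mul_iff₀ hα, mul_one]⟩

end Admissible

/-! ### A smooth cut-off function -/

/-- A smooth even cut-off function: `1` on `[-1, 1]` and `0` off `(-2, 2)`. -/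
def bump (y : ℝ) : ℝ := Real.smoothTransition (2 - y) * Real.smoothTransition (2 + y)

theorem contDiff_bump {n : ℕ∞} : ContDiff ℝ n bump :=
  (Real.smoothTransition.contDiff.comp (contDiff_const.sub contDiff_id)).mul
    (Real.smoothTransition.contDiff.comp (contDiff_const.add contDiff_id))

theorem bump_nonneg (y : ℝ) : 0 ≤ bump y :=
  mul_nonneg (Real.smoothTransition.nonneg _) (Real.smoothTransition.nonneg _)

theorem bump_le_one (y : ℝ) : bump y ≤ 1 :=
  mul_le_one₀ (Real.smoothTransition.le_one _) (Real.smoothTransition.nonneg _)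
    (Real.smoothTransition.le_one _)

theorem bump_eq_one {y : ℝ} (hy : |y| ≤ 1) : bump y = 1 := by
  rw [abs_le] at hy
  rw [bump, Real.smoothTransition.one_of_one_le (by linarith),
    Real.smoothTransition.one_of_one_le (by linarith), one_mul]

theorem bump_eq_zero {y : ℝ} (hy : 2 ≤ |y|) : bump y = 0 := by
  rw [bump, mul_eq_zero, Real.smoothTransition.zero_iff_nonpos,
    Real.smoothTransition.zero_iff_nonpos]
  rcases le_abs.1 hy with h | h
  · left; linarith
  · right; linarith

theorem hasCompactSupport_bump : HasCompactSupport bump :=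
  HasCompactSupport.intro (isCompact_Icc (a := -2) (b := 2)) fun y hy =>
    bump_eq_zero (by
      by_contra h
      rw [not_le, abs_lt] at h
      exact hy ⟨h.1.le, h.2.le⟩)

theorem continuous_bump : Continuous bump := (contDiff_bump (n := 0)).continuous

theorem hasDerivAt_bump (y : ℝ) : HasDerivAt bump (deriv bump y) y :=
  ((contDiff_bump (n := 1)).differentiable one_ne_zero y).hasDerivAt

theorem contDiff_deriv_bump : ContDiff ℝ 1 (deriv bump) :=
  (contDiff_succ_iff_deriv (n := 1).1 (contDiff_bump (n := 2))).2.2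

theorem hasDerivAt_deriv_bump (y : ℝ) : HasDerivAt (deriv bump) (deriv (deriv bump) y) y :=
  (contDiff_deriv_bump.differentiable one_ne_zero y).hasDerivAt

theorem continuous_deriv_bump : Continuous (deriv bump) := contDiff_deriv_bump.continuous

theorem continuous_deriv_deriv_bump : Continuous (deriv (deriv bump)) :=
  contDiff_deriv_bump.continuous_deriv le_rfl

theorem deriv_bump_eq_zero {y : ℝ} (hy : |y| ≤ 1 ∨ 2 ≤ |y|) : deriv bump y = 0 := by
  rcases hy with h | h
  · refine IsLocalMax.deriv_eq_zero (Eventually.of_forall fun z => ?_)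
    rw [bump_eq_one h]
    exact bump_le_one z
  · refine IsLocalMin.deriv_eq_zero (Eventually.of_forall fun z => ?_)
    rw [bump_eq_zero h]
    exact bump_nonneg z

/-- The closed and open conditions match the complement of `Ioc R (2 * R)` after scaling; the
endpoint `|y| = 1` follows by continuity. -/
theorem deriv_deriv_bump_eq_zero {y : ℝ} (hy : |y| ≤ 1 ∨ 2 < |y|) :
    deriv (deriv bump) y = 0 := by
  have key : ∀ y : ℝ, |y| < 1 ∨ 2 < |y| → deriv (deriv bump) y = 0 := fun y hy => by
    have : deriv bump =ᶠ[𝓝 y] fun _ => 0 := by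
      rcases hy with h | h
      · filter_upwards [continuous_abs.continuousAt.eventually_lt continuousAt_const h] with z hz
        exact deriv_bump_eq_zero (Or.inl hz.le)
      · filter_upwards [continuousAt_const.eventually_lt continuous_abs.continuousAt h] with z hz
        exact deriv_bump_eq_zero (Or.inr hz.le)
    rw [this.deriv_eq, deriv_const]
  rcases hy with h | h
  · have h1 : y ∈ closure (Ioo (-1 : ℝ) 1) := by
      rw [closure_Ioo (by norm_num)]
      exact abs_le.1 h
    have h2 : IsClosed {y : ℝ | deriv (deriv bump) y = 0} :=
      isClosed_eq continuous_deriv_deriv_bump continuous_const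
    exact closure_minimal (fun z hz => key z (Or.inl (abs_lt.2 hz))) h2 h1
  · exact key y (Or.inr h)

/-- This sign makes the unbounded drift `-bx` harmless in `barrier_le`. -/
theorem deriv_bump_nonpos {y : ℝ} (hy : -1 ≤ y) : deriv bump y ≤ 0 := by
  rcases le_or_gt y 1 with h | h
  · exact (deriv_bump_eq_zero (Or.inl (abs_le.2 ⟨hy, h⟩))).le
  · have h1 : bump =ᶠ[𝓝 y] fun z => Real.smoothTransition (2 - z) := by
      filter_upwards [Ioi_mem_nhds h] with z hz
      have hz : 1 < z := hz
      rw [bump, Real.smoothTransition.one_of_one_le (x := 2 + z) (by linarith), mul_one]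
    rw [h1.deriv_eq]
    have h2 : Antitone fun z => Real.smoothTransition (2 - z) := fun a b hab =>
      Real.smoothTransition.monotone (by linarith)
    exact h2.deriv_nonpos

theorem exists_bound_deriv_bump :
    ∃ C : ℝ, 0 ≤ C ∧ ∀ y, |deriv bump y| ≤ C ∧ |deriv (deriv bump) y| ≤ C := by
  obtain ⟨C, hC⟩ := continuous_deriv_bump.bounded_above_of_compact_support
    hasCompactSupport_bump.deriv
  obtain ⟨D, hD⟩ := continuous_deriv_deriv_bump.bounded_above_of_compact_support
    hasCompactSupport_bump.deriv.deriv
  exact ⟨max C D, (norm_nonneg _).trans ((hC 0).trans (le_max_left _ _)),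
    fun y => ⟨(hC y).trans (le_max_left _ _), (hD y).trans (le_max_right _ _)⟩⟩

/-! ### The barrier functions -/

/-- The cut-off function at scale `T` in time and `R` in space. -/
def barrier (T R : ℝ) (y : ℝ × ℝ) : ℝ := bump (y.1 / T) * bump (y.2 / R)

/-- `∂ₜ` of the barrier. -/
def barrierT (T R : ℝ) (y : ℝ × ℝ) : ℝ := deriv bump (y.1 / T) / T * bump (y.2 / R)

/-- `∂ₓ` of the barrier. -/
def barrierX (T R : ℝ) (y : ℝ × ℝ) : ℝ := bump (y.1 / T) * (deriv bump (y.2 / R) / R)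

variable (c) in
/-- `ρ⁻¹ ∂ₓ(ρ ∂ₓ w)` for the barrier `w`; the maximum only matters off the support of `∂ₓ w`. -/
def barrierL (T R : ℝ) (y : ℝ × ℝ) : ℝ :=
  bump (y.1 / T) * (deriv (deriv bump) (y.2 / R) / R / R +
    deriv bump (y.2 / R) / R * ((c.delta - 1) / max (y.2 + gamma c (max y.1 0)) R - c.b * y.2))

section

variable {T R : ℝ}

theorem continuous_div_right {f : ℝ → ℝ} (hf : Continuous f) (R : ℝ) :
    Continuous fun x => f (x / R) := hf.comp (continuous_id.div_const R)

theorem hasDerivAt_bump_div (x : ℝ) :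
    HasDerivAt (fun x => bump (x / R)) (deriv bump (x / R) / R) x := by
  have := (hasDerivAt_bump (x / R)).comp x ((hasDerivAt_id x).div_const R)
  simpa [Function.comp_def, div_eq_mul_inv] using this

theorem hasDerivAt_deriv_bump_div (x : ℝ) :
    HasDerivAt (fun x => deriv bump (x / R) / R) (deriv (deriv bump) (x / R) / R / R) x := by
  have := ((hasDerivAt_deriv_bump (x / R)).comp x ((hasDerivAt_id x).div_const R)).div_const R
  simpa [Function.comp_def, div_eq_mul_inv] using this

/-- Functions that vanish off a rectangle at scale `T, R` have compact support. -/
theorem hasCompactSupport_of_rect (hT : 0 < T) (hR : 0 < R) {f : ℝ × ℝ → ℝ}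
    (h : ∀ y, 2 < |y.1 / T| ∨ 2 < |y.2 / R| → f y = 0) : HasCompactSupport f := by
  refine HasCompactSupport.intro
    ((isCompact_Icc (a := -(2 * T)) (b := 2 * T)).prod (isCompact_Icc (a := -(2 * R)) (b := 2 * R)))
    fun y hy => h y ?_
  by_contra hcon
  push Not at hcon
  rw [abs_div, abs_div, abs_of_pos hT, abs_of_pos hR, div_le_iff₀ hT, div_le_iff₀ hR] at hcon
  exact hy ⟨abs_le.1 hcon.1, abs_le.1 hcon.2⟩

theorem isC01_barrier (hT : 0 < T) (hR : 0 < R) : IsC01 (barrier T R) := by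
  refine ⟨?_, hasCompactSupport_of_rect hT hR fun y hy => ?_⟩
  · exact ((contDiff_bump (n := 1)).comp (contDiff_fst.div_const T)).mul
      ((contDiff_bump (n := 1)).comp (contDiff_snd.div_const R))
  · rw [barrier, mul_eq_zero]
    exact hy.imp (fun h => bump_eq_zero h.le) fun h => bump_eq_zero h.le

theorem fderiv_barrier_fst (hT : 0 < T) (hR : 0 < R) (y : ℝ × ℝ) :
    fderiv ℝ (barrier T R) y (1, 0) = barrierT T R y := by
  have h : HasDerivAt (fun t => barrier T R (t, y.2)) (barrierT T R y) y.1 :=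
    (hasDerivAt_bump_div (R := T) y.1).mul_const (bump (y.2 / R))
  exact ((isC01_barrier hT hR).hasDerivAt_fst y).unique h

theorem fderiv_barrier_snd (hT : 0 < T) (hR : 0 < R) (y : ℝ × ℝ) :
    fderiv ℝ (barrier T R) y (0, 1) = barrierX T R y := by
  have h : HasDerivAt (fun x => barrier T R (y.1, x)) (barrierX T R y) y.2 :=
    (hasDerivAt_bump_div (R := R) y.2).const_mul (bump (y.1 / T))
  exact ((isC01_barrier hT hR).hasDerivAt_snd y).unique h

theorem continuous_barrierT : Continuous (barrierT T R) :=
  (((continuous_div_right continuous_deriv_bump T).comp continuous_fst).div_const T).mul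
    ((continuous_div_right continuous_bump R).comp continuous_snd)

theorem hasCompactSupport_barrierT (hT : 0 < T) (hR : 0 < R) :
    HasCompactSupport (barrierT T R) :=
  hasCompactSupport_of_rect hT hR fun y hy => by
    rcases hy with h | h
    · rw [barrierT, deriv_bump_eq_zero (Or.inr h.le), zero_div, zero_mul]
    · rw [barrierT, bump_eq_zero h.le, mul_zero]

theorem continuous_barrierX : Continuous (barrierX T R) :=
  ((continuous_div_right continuous_bump T).comp continuous_fst).mul
    (((continuous_div_right continuous_deriv_bump R).comp continuous_snd).div_const R)

theorem hasCompactSupport_barrierX (hT : 0 < T) (hR : 0 < R) :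
    HasCompactSupport (barrierX T R) :=
  hasCompactSupport_of_rect hT hR fun y hy => by
    rcases hy with h | h
    · rw [barrierX, bump_eq_zero h.le, zero_mul]
    · rw [barrierX, deriv_bump_eq_zero (Or.inr h.le), zero_div, mul_zero]

theorem hasCompactSupport_barrierL (hT : 0 < T) (hR : 0 < R) :
    HasCompactSupport (barrierL c T R) :=
  hasCompactSupport_of_rect hT hR fun y hy => by
    rcases hy with h | h
    · rw [barrierL, bump_eq_zero h.le, zero_mul]
    · rw [barrierL, deriv_bump_eq_zero (Or.inr h.le), deriv_deriv_bump_eq_zero (Or.inr h)]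
      simp

theorem Admissible.continuous_barrierL (hc : Admissible c) (hR : 0 < R) :
    Continuous (barrierL c T R) := by
  have h1 := (continuous_div_right continuous_bump T).comp (continuous_fst (X := ℝ) (Y := ℝ))
  have h2 := (continuous_div_right continuous_deriv_bump R).comp
    (continuous_snd (X := ℝ) (Y := ℝ))
  have h3 := (continuous_div_right continuous_deriv_deriv_bump R).comp
    (continuous_snd (X := ℝ) (Y := ℝ))
  have h4 := hc.continuous_gamma.comp (continuous_fst (X := ℝ) (Y := ℝ))
  refine h1.mul (((h3.div_const R).div_const R).add ((h2.div_const R).mul ?_))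
  exact (continuous_const.div ((continuous_snd.add h4).max continuous_const)
    fun y => (lt_max_of_lt_right hR).ne').sub (continuous_const.mul continuous_snd)

end

/-! ### Integration by parts against the reference measure -/

/-- On `[R, 2R]` the weight is smooth because `x + γ ≥ R > 0`. The boundary terms vanish since
`bump'` is zero at `1` and `2`. -/
theorem integral_weight_mul_deriv {δ b γ R : ℝ} (hδ : 1 ≤ δ) (hγ : 0 ≤ γ) (hR : 0 < R)
    {v v' : ℝ → ℝ} (hv : ∀ x, HasDerivAt v (v' x) x) (hv' : Continuous v') :
    ∫ x in R..2 * R, (x + γ) ^ (δ - 1) * Real.exp (-(b * x ^ 2 / 2)) *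
        (deriv bump (x / R) / R) * v' x =
      -∫ x in R..2 * R, (x + γ) ^ (δ - 1) * Real.exp (-(b * x ^ 2 / 2)) *
        (deriv (deriv bump) (x / R) / R / R + deriv bump (x / R) / R *
          ((δ - 1) / max (x + γ) R - b * x)) * v x := by
  have hle : R ≤ 2 * R := by linarith
  have ha : Continuous fun x : ℝ => (x + γ) ^ (δ - 1) * Real.exp (-(b * x ^ 2 / 2)) :=
    ((continuous_id.add continuous_const).rpow_const fun _ => Or.inr (sub_nonneg.2 hδ)).mul
      (by fun_prop)
  have hu : ∀ x ∈ uIcc R (2 * R), HasDerivAt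
      (fun x : ℝ => (x + γ) ^ (δ - 1) * Real.exp (-(b * x ^ 2 / 2)) * (deriv bump (x / R) / R))
      ((x + γ) ^ (δ - 1) * Real.exp (-(b * x ^ 2 / 2)) *
        (deriv (deriv bump) (x / R) / R / R + deriv bump (x / R) / R *
          ((δ - 1) / max (x + γ) R - b * x))) x := fun x hx => by
    rw [uIcc_of_le hle] at hx
    have hpos : 0 < x + γ := by linarith [hx.1]
    have h1 : HasDerivAt (fun x : ℝ => (x + γ) ^ (δ - 1))
        (1 * (δ - 1) * (x + γ) ^ (δ - 1 - 1)) x :=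
      ((hasDerivAt_id x).add_const γ).rpow_const (Or.inl hpos.ne')
    have h2 : HasDerivAt (fun x : ℝ => Real.exp (-(b * x ^ 2 / 2)))
        (Real.exp (-(b * x ^ 2 / 2)) * (-(b * (2 * x) / 2))) x := by
      have := ((((hasDerivAt_pow 2 x).const_mul b).div_const 2).neg).exp
      simpa using this
    refine ((h1.mul h2).mul (hasDerivAt_deriv_bump_div x)).congr_deriv ?_
    rw [max_eq_left (by linarith [hx.1] : R ≤ x + γ), Real.rpow_sub_one hpos.ne' (δ - 1)]
    simp only [Pi.mul_apply]
    field_simp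
    ring
  have hu' : Continuous fun x : ℝ => (x + γ) ^ (δ - 1) * Real.exp (-(b * x ^ 2 / 2)) *
        (deriv (deriv bump) (x / R) / R / R + deriv bump (x / R) / R *
          ((δ - 1) / max (x + γ) R - b * x)) := by
    refine ha.mul (((((continuous_div_right continuous_deriv_deriv_bump R)).div_const R).div_const
      R).add (((continuous_div_right continuous_deriv_bump R).div_const R).mul ?_))
    exact (continuous_const.div (by fun_prop) fun x => (lt_max_of_lt_right hR).ne').sub
      (by fun_prop)
  rw [intervalIntegral.integral_mul_deriv_eq_deriv_mul hu (fun x _ => hv x)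
    (hu'.intervalIntegrable _ _) (hv'.intervalIntegrable _ _), mul_div_cancel_right₀ _ hR.ne',
    div_self hR.ne', deriv_bump_eq_zero (Or.inr (by norm_num)),
    deriv_bump_eq_zero (Or.inl (by norm_num))]
  simp

theorem Admissible.integral_refMeasure (hc : Admissible c) {F : ℝ × ℝ → ℝ}
    (hF : Integrable F (refMeasure c)) :
    ∫ y, F y ∂refMeasure c = ∫ t, ∫ x, (dens c (t, x)).toReal * F (t, x) := by
  have hlt : ∀ᵐ y : ℝ × ℝ, dens c y < ⊤ := ae_of_all _ fun y => by
    by_cases h : y ∈ dom c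
    · rw [dens, indicator_of_mem h]; exact ENNReal.ofReal_lt_top
    · rw [dens, indicator_of_notMem h]; exact ENNReal.zero_lt_top
  rw [hc.refMeasure_eq] at hF ⊢
  rw [integrable_withDensity_iff_integrable_smul' hc.measurable_dens hlt] at hF
  rw [integral_withDensity_eq_integral_toReal_smul hc.measurable_dens hlt]
  exact integral_prod _ hF

theorem integral_eq_intervalIntegral {F G : ℝ → ℝ} {a b : ℝ} (hab : a ≤ b)
    (h0 : ∀ x, x ∉ Ioc a b → F x = 0) (h : ∀ x ∈ Ioc a b, F x = G x) :
    ∫ x, F x = ∫ x in a..b, G x := by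
  rw [intervalIntegral.integral_of_le hab, ← setIntegral_congr_fun measurableSet_Ioc h,
    setIntegral_eq_integral_of_forall_compl_eq_zero h0]

theorem rho_eq_of_beta_le {t x : ℝ} (h : beta c t ≤ x) (h' : 0 ≤ x + gamma c t) :
    rho c t x = c.p * ((x + gamma c t) ^ (c.delta - 1) * Real.exp (-(c.b * x ^ 2 / 2))) := by
  rw [rho, indicator_of_notMem (by simp [h]), indicator_of_mem (mem_Ici.2 h), abs_of_nonneg h']
  ring

section

variable {T R : ℝ}

/-- For `0 ≤ t < 2T` the slice of `E` lies in `x ≥ -R`, so `∂ₓw` is felt only on `(R, 2R]`. There `x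
> β(t)`, and `ρ` reduces to its smooth branch with factor `p`. For other `t` both sides are zero. -/
theorem Admissible.integral_slice (hc : Admissible c) (hT : 0 < T) (hR : 0 < R)
    (hRγ : gamma c (2 * T) ≤ R) (hRl : c.lam 0 ≤ R) (t : ℝ) {v v' : ℝ → ℝ}
    (hv : ∀ x, HasDerivAt v (v' x) x) (hv' : Continuous v') :
    ∫ x, (dens c (t, x)).toReal * (barrierX T R (t, x) * v' x) =
      -∫ x, (dens c (t, x)).toReal * (barrierL c T R (t, x) * v x) := by
  rcases lt_or_ge t 0 with ht | ht
  · have : ∀ x, dens c (t, x) = 0 := fun x =>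
      indicator_of_notMem (fun h => absurd h.1 (not_le.2 ht)) _
    simp [this]
  rcases le_or_gt (2 * T) t with htT | htT
  · have : bump (t / T) = 0 := bump_eq_zero (by
      rw [abs_of_nonneg (by positivity), le_div_iff₀ hT]; exact htT)
    simp [barrierX, barrierL, this]
  have hγ0 : 0 ≤ gamma c t := Admissible.gamma_nonneg ht
  have hγR : gamma c t ≤ R := (hc.gamma_mono ht htT.le).trans hRγ
  have hβ : beta c t ≤ R := (Admissible.beta_le ht).trans hRl
  have hout : ∀ x, x ∉ Ioc R (2 * R) → dens c (t, x) = 0 ∨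
      (|x / R| ≤ 1 ∨ 2 < |x / R|) := fun x hx => by
    by_cases hd : (t, x) ∈ dom c
    · right
      have hd2 : -gamma c t ≤ x := hd.2
      rcases le_or_gt x R with h | h
      · left
        rw [abs_div, abs_of_pos hR, div_le_one hR, abs_le]
        exact ⟨by linarith, h⟩
      · right
        have h2 : 2 * R < x := by
          by_contra h3
          exact hx ⟨h, not_lt.1 h3⟩
        rw [abs_div, abs_of_pos hR, lt_div_iff₀ hR, abs_of_pos (hR.trans h)]
        exact h2
    · left
      exact indicator_of_notMem hd _
  have hin : ∀ x ∈ Ioc R (2 * R), (dens c (t, x)).toReal =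
      c.p * ((x + gamma c t) ^ (c.delta - 1) * Real.exp (-(c.b * x ^ 2 / 2))) := fun x hx => by
    have hx1 : R < x := hx.1
    have hd : (t, x) ∈ dom c := ⟨ht, by linarith⟩
    rw [dens, indicator_of_mem hd, ENNReal.toReal_ofReal (hc.rho_nonneg _ _),
      rho_eq_of_beta_le (by linarith) (by linarith)]
  have hle : R ≤ 2 * R := by linarith
  rw [integral_eq_intervalIntegral (G := fun x => c.p * bump (t / T) *
      ((x + gamma c t) ^ (c.delta - 1) * Real.exp (-(c.b * x ^ 2 / 2)) *
        (deriv bump (x / R) / R) * v' x)) hle ?_ ?_,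
    integral_eq_intervalIntegral (G := fun x => c.p * bump (t / T) *
      ((x + gamma c t) ^ (c.delta - 1) * Real.exp (-(c.b * x ^ 2 / 2)) *
        (deriv (deriv bump) (x / R) / R / R + deriv bump (x / R) / R *
          ((c.delta - 1) / max (x + gamma c t) R - c.b * x)) * v x)) hle ?_ ?_,
    intervalIntegral.integral_const_mul, intervalIntegral.integral_const_mul,
    integral_weight_mul_deriv hc.one_le_delta hγ0 hR hv hv', mul_neg]
  · intro x hx
    rcases hout x hx with h | h
    · rw [h, ENNReal.toReal_zero, zero_mul]
    · simp only [barrierL]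
      rw [deriv_bump_eq_zero (h.imp_right le_of_lt), deriv_deriv_bump_eq_zero h]
      simp
  · intro x hx
    rw [hin x hx]
    simp only [barrierL]
    rw [max_eq_left ht]
    ring
  · intro x hx
    rcases hout x hx with h | h
    · rw [h, ENNReal.toReal_zero, zero_mul]
    · simp only [barrierX]
      rw [deriv_bump_eq_zero (h.imp_right le_of_lt)]
      simp
  · intro x hx
    rw [hin x hx]
    simp only [barrierX]
    ring

end

/-! ### The barriers in the domain of the generator -/

namespace Admissible

/-- The class in `𝓗` of a continuous function with compact support. -/
def ofTest (hc : Admissible c) {g : ℝ × ℝ → ℝ} (hg : Continuous g) (hg' : HasCompactSupport g) :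
    H c := (hc.memLp_of_continuous hg hg' 2).toLp g

theorem coeFn_ofTest (hc : Admissible c) {g : ℝ × ℝ → ℝ} (hg : Continuous g)
    (hg' : HasCompactSupport g) : hc.ofTest hg hg' =ᵐ[refMeasure c] g :=
  MemLp.coeFn_toLp (hc.memLp_of_continuous hg hg' 2)

variable {T R : ℝ}

theorem inner_barrierX (hc : Admissible c) (hT : 0 < T) (hR : 0 < R)
    (hRγ : gamma c (2 * T) ≤ R) (hRl : c.lam 0 ≤ R) (v : V c) :
    inner ℝ (hc.ofTest continuous_barrierX (hasCompactSupport_barrierX hT hR)) (dx c v) =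
      -inner ℝ (hc.ofTest (hc.continuous_barrierL hR) (hasCompactSupport_barrierL hT hR))
        (toH c v) := by
  have hcl : IsClosed {v : HH c |
      inner ℝ (hc.ofTest continuous_barrierX (hasCompactSupport_barrierX hT hR)) v.snd =
        -inner ℝ (hc.ofTest (hc.continuous_barrierL hR) (hasCompactSupport_barrierL hT hR))
          v.fst} :=
    isClosed_eq (continuous_const.inner (WithLp.continuous_snd 2 _ _))
      (continuous_const.inner (WithLp.continuous_fst 2 _ _)).neg
  refine closure_minimal ?_ hcl v.2
  rintro w ⟨u, hu, h1, h2⟩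
  have hi1 : Integrable (fun y => barrierX T R y * fderiv ℝ u y (0, 1)) (refMeasure c) :=
    memLp_one_iff_integrable.1 (hc.memLp_of_continuous
      (continuous_barrierX.mul (hu.continuous_fderiv _))
      (hasCompactSupport_barrierX hT hR).mul_right 1)
  have hi2 : Integrable (fun y => barrierL c T R y * u y) (refMeasure c) :=
    memLp_one_iff_integrable.1 (hc.memLp_of_continuous
      ((hc.continuous_barrierL hR).mul hu.1.continuous)
      (hasCompactSupport_barrierL hT hR).mul_right 1)
  have e1 : ∫ y, hc.ofTest continuous_barrierX (hasCompactSupport_barrierX hT hR) y * w.snd y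
      ∂refMeasure c = ∫ y, barrierX T R y * fderiv ℝ u y (0, 1) ∂refMeasure c := by
    refine integral_congr_ae ?_
    filter_upwards [h2, hc.coeFn_ofTest continuous_barrierX (hasCompactSupport_barrierX hT hR)]
      with y a b
    rw [a, b, (hu.hasDerivAt_snd y).deriv]
  have e2 : ∫ y, hc.ofTest (hc.continuous_barrierL hR) (hasCompactSupport_barrierL hT hR) y *
      w.fst y ∂refMeasure c = ∫ y, barrierL c T R y * u y ∂refMeasure c := by
    refine integral_congr_ae ?_
    filter_upwards [h1, hc.coeFn_ofTest (hc.continuous_barrierL hR)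
      (hasCompactSupport_barrierL hT hR)] with y a b
    rw [a, b]
  rw [mem_ofPred_eq, inner_eq_integral, inner_eq_integral, e1, e2, hc.integral_refMeasure hi1,
    hc.integral_refMeasure hi2, ← integral_neg]
  congr 1
  ext t
  exact hc.integral_slice hT hR hRγ hRl t (v := fun x => u (t, x))
    (fun x => hu.hasDerivAt_snd (t, x)) ((hu.continuous_fderiv _).comp (by fun_prop))

/-- The barrier is a test function with classical derivatives, so it lies in the core of `∂ₜ`;
`inner_barrierX` turns `𝓐(w, v)` into `-(σ²/8)(Lw, v)`. -/
theorem isResolvent_barrier (hc : Admissible c) (α : ℝ) (hT : 0 < T) (hR : 0 < R)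
    (hRγ : gamma c (2 * T) ≤ R) (hRl : c.lam 0 ≤ R) :
    IsResolvent c α
      (α • hc.ofTest (isC01_barrier hT hR).1.continuous (isC01_barrier hT hR).2 -
        hc.ofTest continuous_barrierT (hasCompactSupport_barrierT hT hR) -
        (c.sigma ^ 2 / 8) •
          hc.ofTest (hc.continuous_barrierL hR) (hasCompactSupport_barrierL hT hR))
      (hc.ofTest (isC01_barrier hT hR).1.continuous (isC01_barrier hT hR).2) := by
  have hu := isC01_barrier hT hR
  set w := hc.ofTest hu.1.continuous hu.2 with hw
  set wT := hc.ofTest continuous_barrierT (hasCompactSupport_barrierT hT hR) with hwT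
  set wX := hc.ofTest continuous_barrierX (hasCompactSupport_barrierX hT hR) with hwX
  have hmem : (WithLp.toLp 2 (w, wX) : HH c) ∈ V c := by
    refine (gradGraph c).le_topologicalClosure ⟨_, hu,
      hc.coeFn_ofTest hu.1.continuous hu.2, ?_⟩
    filter_upwards [hc.coeFn_ofTest continuous_barrierX (hasCompactSupport_barrierX hT hR)] with y h
    refine h.trans ?_
    rw [(hu.hasDerivAt_snd y).deriv, fderiv_barrier_snd hT hR]
  refine ⟨(⟨_, hmem⟩, (innerSL ℝ wT).comp (toHL c)), subset_closure ⟨wT, ?_, fun v => rfl⟩, rfl,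
    fun v => ?_⟩
  · refine hc.hasTimeDeriv_of_isC01 hu (hc.coeFn_ofTest hu.1.continuous hu.2) ?_
    filter_upwards [hc.coeFn_ofTest continuous_barrierT (hasCompactSupport_barrierT hT hR)] with y h
    exact h.trans (fderiv_barrier_fst hT hR y).symm
  · have h1 : dx c ⟨_, hmem⟩ = wX := rfl
    have h2 : toH c ⟨_, hmem⟩ = w := rfl
    have h3 : ((innerSL ℝ wT).comp (toHL c)) v = inner ℝ wT (toH c v) := rfl
    simp only [formE, formA]
    rw [h1, h2, h3, hc.inner_barrierX hT hR hRγ hRl, inner_sub_left, inner_sub_left,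
      real_inner_smul_left, real_inner_smul_left]
    ring

/-- Only lower bounds on `∂ₜw` and `Lw` are needed. On `E`, outside the rectangle, either `t > 2T`
or `x > 2R`, and all three terms vanish. -/
theorem barrier_le (hc : Admissible c) {α C : ℝ} (hα : 0 < α) (hT : 1 ≤ T) (hTR : T ≤ R)
    (hRγ : gamma c (2 * T) ≤ R)
    (hC : ∀ y, |deriv bump y| ≤ C ∧ |deriv (deriv bump) y| ≤ C) {y : ℝ × ℝ} (hy : y ∈ dom c) :
    α * barrier T R y - barrierT T R y - c.sigma ^ 2 / 8 * barrierL c T R y ≤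
      (Icc 0 (2 * T) ×ˢ Icc (-R) (2 * R)).indicator
        (fun _ => α + (C + c.sigma ^ 2 / 8 * (C * c.delta)) / T) y := by
  have hT0 : 0 < T := by linarith
  have hR0 : 0 < R := by linarith
  have hC0 : 0 ≤ C := (abs_nonneg _).trans (hC 0).1
  have hy1 : 0 ≤ y.1 := hy.1
  have hy2 : y.1 ≤ 2 * T → -R ≤ y.2 := fun h =>
    (neg_le_neg ((hc.gamma_mono hy.1 h).trans hRγ)).trans hy.2
  by_cases hK : y ∈ Icc 0 (2 * T) ×ˢ Icc (-R) (2 * R)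
  swap
  · rw [indicator_of_notMem hK]
    rcases lt_or_ge (2 * T) y.1 with h | h
    · have h' : 2 < |y.1 / T| := by
        rw [abs_of_nonneg (by positivity), lt_div_iff₀ hT0]; exact h
      rw [barrier, barrierT, barrierL, bump_eq_zero h'.le, deriv_bump_eq_zero (Or.inr h'.le)]
      simp
    · have h2 : 2 * R < y.2 := by
        by_contra h3
        exact hK ⟨⟨hy1, h⟩, hy2 h, not_lt.1 h3⟩
      have h' : 2 < |y.2 / R| := by
        rw [abs_of_pos (div_pos (by linarith) hR0), lt_div_iff₀ hR0]; exact h2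
      rw [barrier, barrierT, barrierL, bump_eq_zero h'.le, deriv_bump_eq_zero (Or.inr h'.le),
        deriv_deriv_bump_eq_zero (Or.inr h')]
      simp
  rw [indicator_of_mem hK]
  have b1 : barrier T R y ≤ 1 := mul_le_one₀ (bump_le_one _) (bump_nonneg _) (bump_le_one _)
  have b2 : -(C / T) ≤ barrierT T R y := by
    refine neg_le_of_abs_le ?_
    rw [barrierT, abs_mul, abs_div, abs_of_pos hT0, abs_of_nonneg (bump_nonneg _)]
    calc _ ≤ C / T * 1 := by
          gcongr
          · exact bump_nonneg _
          · exact (hC _).1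
          · exact bump_le_one _
      _ = _ := mul_one _
  have b3 : -(C * c.delta / T) ≤ barrierL c T R y := by
    have hB : 0 ≤ C * c.delta / T :=
      div_nonneg (mul_nonneg hC0 (zero_le_one.trans hc.one_le_delta)) hT0.le
    -- The second-order term costs `C/R²` and the Bessel drift `C(δ - 1)/R²`, in total `Cδ/R² ≤
    -- Cδ/T` because `R ≥ T ≥ 1`. The product of `bump' ≤ 0` and `-bx ≤ 0` is nonnegative and is
    -- dropped.
    have key : -(C * c.delta / T) ≤ deriv (deriv bump) (y.2 / R) / R / R +
        deriv bump (y.2 / R) / R *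
          ((c.delta - 1) / max (y.2 + gamma c (max y.1 0)) R - c.b * y.2) := by
      have hyR : -R ≤ y.2 := hK.2.1
      rcases le_or_gt y.2 R with h | h
      · have h' : |y.2 / R| ≤ 1 := by
          rw [abs_div, abs_of_pos hR0, div_le_one hR0, abs_le]; exact ⟨hyR, h⟩
        rw [deriv_bump_eq_zero (Or.inl h'), deriv_deriv_bump_eq_zero (Or.inl h')]
        simpa using hB
      · have h1 : deriv bump (y.2 / R) ≤ 0 := deriv_bump_nonpos (by
          have := div_pos (hR0.trans h) hR0
          linarith)
        have h2 : -C ≤ deriv bump (y.2 / R) := neg_le_of_abs_le (hC _).1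
        have h3 : -C ≤ deriv (deriv bump) (y.2 / R) := neg_le_of_abs_le (hC _).2
        have hδ : 0 ≤ c.delta - 1 := sub_nonneg.2 hc.one_le_delta
        have h4 : (c.delta - 1) / max (y.2 + gamma c (max y.1 0)) R ≤ (c.delta - 1) / R := by
          gcongr
          exact le_max_right _ _
        have h5 : 0 ≤ c.b * y.2 := mul_nonneg hc.b_nonneg (hR0.trans h).le
        have h6 : -C / R / R ≤ deriv (deriv bump) (y.2 / R) / R / R := by gcongr
        have h7 : -C / R * ((c.delta - 1) / R) ≤ deriv bump (y.2 / R) / R *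
            ((c.delta - 1) / max (y.2 + gamma c (max y.1 0)) R - c.b * y.2) := by
          calc -C / R * ((c.delta - 1) / R) ≤ deriv bump (y.2 / R) / R * ((c.delta - 1) / R) := by
                gcongr
            _ ≤ _ := mul_le_mul_of_nonpos_left (by linarith)
                (div_nonpos_of_nonpos_of_nonneg h1 hR0.le)
        have h8 : C * c.delta / R / R ≤ C * c.delta / T := by
          rw [div_div]
          have := zero_le_one.trans hc.one_le_delta
          gcongr
          nlinarith
        have h9 : -C / R / R + -C / R * ((c.delta - 1) / R) = -(C * c.delta / R / R) := by
          field_simp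
          ring
        linarith
    have hb0 := bump_nonneg (y.1 / T)
    have hb1 := bump_le_one (y.1 / T)
    rw [barrierL]
    nlinarith
  have b4 := mul_le_mul_of_nonneg_left b3 (by positivity : 0 ≤ c.sigma ^ 2 / 8)
  have b5 := mul_le_mul_of_nonneg_left b1 hα.le
  have b6 : (C + c.sigma ^ 2 / 8 * (C * c.delta)) / T =
      C / T + c.sigma ^ 2 / 8 * (C * c.delta / T) := by ring
  linarith

/-- The indicator function of a compact set as an element of `𝓗`. -/
def indicatorH (hc : Admissible c) {K : Set (ℝ × ℝ)} (hK : IsCompact K) : H c :=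
  indicatorConstLp 2 hK.measurableSet (hc.refMeasure_lt_top_of_isCompact hK).ne (1 : ℝ)

theorem coeFn_indicatorH (hc : Admissible c) {K : Set (ℝ × ℝ)} (hK : IsCompact K) :
    hc.indicatorH hK =ᵐ[refMeasure c] K.indicator fun _ => 1 :=
  indicatorConstLp_coeFn

theorem barrier_le_resolvent (hc : Admissible c) {α C : ℝ} (hα : 0 < α) (hT : 1 ≤ T) (hTR : T ≤ R)
    (hRγ : gamma c (2 * T) ≤ R) (hRl : c.lam 0 ≤ R)
    (hC : ∀ y, |deriv bump y| ≤ C ∧ |deriv (deriv bump) y| ≤ C) :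
    ∀ᵐ y ∂refMeasure c, barrier T R y ≤
      (α + (C + c.sigma ^ 2 / 8 * (C * c.delta)) / T) *
        resolvent c α (hc.indicatorH
          ((isCompact_Icc (a := 0) (b := 2 * T)).prod (isCompact_Icc (a := -R) (b := 2 * R)))) y := by
  have hT0 : 0 < T := by linarith
  have hR0 : 0 < R := by linarith
  set κ := α + (C + c.sigma ^ 2 / 8 * (C * c.delta)) / T
  set I := hc.indicatorH
    ((isCompact_Icc (a := 0) (b := 2 * T)).prod (isCompact_Icc (a := -R) (b := 2 * R))) with hI
  have hu := isC01_barrier hT0 hR0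
  have h1 := hc.mono_of_isResolvent hα (hc.isResolvent_barrier α hT0 hR0 hRγ hRl)
    (hc.isResolvent_smul κ (hc.isResolvent_resolvent hα I)) (by
      filter_upwards [Lp.coeFn_smul κ I, hc.coeFn_indicatorH
          ((isCompact_Icc (a := 0) (b := 2 * T)).prod (isCompact_Icc (a := -R) (b := 2 * R))),
        Lp.coeFn_sub (α • hc.ofTest hu.1.continuous hu.2 -
          hc.ofTest continuous_barrierT (hasCompactSupport_barrierT hT0 hR0))
          ((c.sigma ^ 2 / 8) •
            hc.ofTest (hc.continuous_barrierL hR0) (hasCompactSupport_barrierL hT0 hR0)),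
        Lp.coeFn_sub (α • hc.ofTest hu.1.continuous hu.2)
          (hc.ofTest continuous_barrierT (hasCompactSupport_barrierT hT0 hR0)),
        Lp.coeFn_smul α (hc.ofTest hu.1.continuous hu.2),
        Lp.coeFn_smul (c.sigma ^ 2 / 8)
          (hc.ofTest (hc.continuous_barrierL hR0) (hasCompactSupport_barrierL hT0 hR0)),
        hc.coeFn_ofTest hu.1.continuous hu.2,
        hc.coeFn_ofTest continuous_barrierT (hasCompactSupport_barrierT hT0 hR0),
        hc.coeFn_ofTest (hc.continuous_barrierL hR0) (hasCompactSupport_barrierL hT0 hR0),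
        hc.ae_mem_dom] with y e1 e2 e3 e4 e5 e6 e7 e8 e9 hy
      rw [e3, Pi.sub_apply, e4, Pi.sub_apply, e5, e6, Pi.smul_apply, Pi.smul_apply, e7, e8, e9, e1,
        Pi.smul_apply, hI, e2, smul_eq_mul, smul_eq_mul, smul_eq_mul]
      refine (hc.barrier_le hα hT hTR hRγ hC hy).trans (le_of_eq ?_)
      by_cases hK : y ∈ Icc 0 (2 * T) ×ˢ Icc (-R) (2 * R)
      · rw [indicator_of_mem hK, indicator_of_mem hK, mul_one]
      · rw [indicator_of_notMem hK, indicator_of_notMem hK, mul_zero])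
  filter_upwards [h1, hc.coeFn_ofTest hu.1.continuous hu.2, Lp.coeFn_smul κ (resolvent c α I)]
    with y a1 a2 a3
  rwa [a2, a3, Pi.smul_apply, smul_eq_mul] at a1

/-! ### Conservativeness -/

theorem exists_increasesTo (hc : Admissible c) : ∃ a : ℕ → H c, IncreasesTo c a (oneE c) := by
  refine ⟨fun n => hc.indicatorH (isCompact_closedBall (0 : ℝ × ℝ) n), ?_⟩
  have h := ae_all_iff.2 fun n : ℕ => hc.coeFn_indicatorH (isCompact_closedBall (0 : ℝ × ℝ) n)
  filter_upwards [h, hc.ae_mem_dom] with y hy hd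
  simp only [hy]
  refine ⟨fun n => indicator_nonneg (fun _ _ => zero_le_one) _, fun m n hmn => ?_, ?_⟩
  · exact indicator_le_indicator_of_subset
      (Metric.closedBall_subset_closedBall (Nat.cast_le.2 hmn)) (fun _ => zero_le_one) y
  · obtain ⟨N, hN⟩ := exists_nat_ge (dist y 0)
    refine tendsto_const_nhds.congr' ?_
    filter_upwards [eventually_ge_atTop N] with n hn
    rw [oneE, indicator_of_mem hd, indicator_of_mem]
    exact hN.trans (Nat.cast_le.2 hn)

/-- The functions `a_n ∧ 𝟙_K` converge to `𝟙_K` in `L²`, unlike `a_n`, whose limit need not lie in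
`𝓗`. The bound `M` is quantified after the null set so that it may depend on the point. -/
theorem resolvent_indicator_le (hc : Admissible c) {α : ℝ} (hα : 0 < α) {a : ℕ → H c}
    (ha : IncreasesTo c a (oneE c)) {K : Set (ℝ × ℝ)} (hK : IsCompact K) :
    ∀ᵐ y ∂refMeasure c, ∀ M, (∀ n, resolvent c α (a n) y ≤ M) →
      resolvent c α (hc.indicatorH hK) y ≤ M := by
  have hI := hc.coeFn_indicatorH hK
  have hb : Tendsto (fun n => a n ⊓ hc.indicatorH hK) atTop (𝓝 (hc.indicatorH hK)) := by
    refine tendsto_Lp_of_dominated (G := K.indicator fun _ => 1)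
      (f := fun n y => min (a n y) (K.indicator (fun _ => 1) y)) ?_ (fun n => ?_) hI ?_ ?_
    · exact memLp_indicator_const 2 hK.measurableSet _
        (Or.inr (hc.refMeasure_lt_top_of_isCompact hK).ne)
    · filter_upwards [Lp.coeFn_inf (a n) (hc.indicatorH hK), hI] with y h1 h2
      rw [h1, Pi.inf_apply, h2]
    · refine Eventually.of_forall fun n => ?_
      filter_upwards [ha] with y hy
      have h0 : 0 ≤ K.indicator (fun _ => (1 : ℝ)) y := indicator_nonneg (fun _ _ => zero_le_one) _
      have h1 := le_min (hy.1 n) h0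
      rw [abs_sub_comm, abs_of_nonneg (sub_nonneg.2 (min_le_right _ _))]
      linarith
    · filter_upwards [ha, hc.ae_mem_dom] with y hy hd
      have h1 := hy.2.2.min (tendsto_const_nhds (x := K.indicator (fun _ => (1 : ℝ)) y))
      rwa [oneE, indicator_of_mem hd,
        min_eq_right (indicator_le_self' (fun _ _ => zero_le_one) y)] at h1
  have hG : Tendsto (fun n => resolvent c α (a n ⊓ hc.indicatorH hK)) atTop
      (𝓝 (resolvent c α (hc.indicatorH hK))) := by
    rw [tendsto_iff_norm_sub_tendsto_zero] at hb ⊢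
    have := hb.const_mul α⁻¹
    rw [mul_zero] at this
    exact squeeze_zero (fun _ => norm_nonneg _) (fun n => hc.norm_resolvent_sub_le hα _ _) this
  obtain ⟨ms, -, hms⟩ := (tendstoInMeasure_of_tendsto_Lp hG).exists_seq_tendsto_ae
  have hle : ∀ᵐ y ∂refMeasure c, ∀ n,
      resolvent c α (a n ⊓ hc.indicatorH hK) y ≤ resolvent c α (a n) y := by
    refine ae_all_iff.2 fun n => ?_
    refine hc.mono_of_isResolvent hα (hc.isResolvent_resolvent hα _)
      (hc.isResolvent_resolvent hα _) ?_
    filter_upwards [Lp.coeFn_inf (a n) (hc.indicatorH hK)] with y h1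
    rw [h1]
    exact min_le_left _ _
  filter_upwards [hms, hle] with y h1 h2 M hM
  exact le_of_tendsto h1 (Eventually.of_forall fun n => (h2 _).trans (hM _))

theorem extendsTo_one (hc : Admissible c) {α : ℝ} (hα : 0 < α) :
    ExtendsTo c (fun f => α • resolvent c α f) (oneE c) (oneE c) := by
  refine ⟨hc.exists_increasesTo, fun a ha => ?_⟩
  obtain ⟨C, hC0, hC⟩ := exists_bound_deriv_bump
  set D := C + c.sigma ^ 2 / 8 * (C * c.delta)
  let T : ℕ → ℝ := fun k => k + 1
  -- The three terms secure `T ≤ R`, the absence of the moving boundary from `x < -R` up to time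
  -- `2T`, and `β ≤ R`.
  let R : ℕ → ℝ := fun k => max (T k) (max (gamma c (2 * T k)) (c.lam 0))
  have hT1 : ∀ k, 1 ≤ T k := fun k => by simp [T]
  have hTR : ∀ k, T k ≤ R k := fun k => le_max_left _ _
  have hmono : ∀ᵐ y ∂refMeasure c, ∀ n, resolvent c α (a n) y ≤ resolvent c α (a (n + 1)) y := by
    refine ae_all_iff.2 fun n => hc.mono_of_isResolvent hα (hc.isResolvent_resolvent hα _)
      (hc.isResolvent_resolvent hα _) ?_
    filter_upwards [ha] with y hy
    exact hy.2.1 n.le_succ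
  have hle : ∀ᵐ y ∂refMeasure c, ∀ n, resolvent c α (a n) y ≤ α⁻¹ := by
    refine ae_all_iff.2 fun n => hc.le_of_isResolvent hα (hc.isResolvent_resolvent hα _) ?_
    filter_upwards [ha, hc.ae_mem_dom] with y hy hd
    have := hy.2.1.ge_of_tendsto hy.2.2 n
    rwa [oneE, indicator_of_mem hd] at this
  have hbar := ae_all_iff.2 fun k => hc.barrier_le_resolvent hα (hT1 k) (hTR k)
    ((le_max_left _ _).trans (le_max_right _ _)) ((le_max_right _ _).trans (le_max_right _ _)) hC
  have hind := ae_all_iff.2 fun k => hc.resolvent_indicator_le hα ha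
    ((isCompact_Icc (a := 0) (b := 2 * T k)).prod (isCompact_Icc (a := -R k) (b := 2 * R k)))
  filter_upwards [hmono, hle, hbar, hind, hc.ae_mem_dom,
    ae_all_iff.2 fun n => Lp.coeFn_smul α (resolvent c α (a n))] with y h1 h2 h3 h4 hd h5
  have hm : Monotone fun n => resolvent c α (a n) y := monotone_nat_of_le_succ h1
  have hbdd : BddAbove (range fun n => resolvent c α (a n) y) :=
    ⟨α⁻¹, by rintro _ ⟨n, rfl⟩; exact h2 n⟩
  have hlim := tendsto_atTop_ciSup hm hbdd
  set L := ⨆ n, resolvent c α (a n) y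
  have hLle : L ≤ α⁻¹ := ciSup_le h2
  have hκ : ∀ k, 0 ≤ α + D / T k := fun k => by
    have : 0 ≤ D := add_nonneg hC0 (mul_nonneg (by positivity)
      (mul_nonneg hC0 (zero_le_one.trans hc.one_le_delta)))
    have := div_nonneg this (zero_le_one.trans (hT1 k))
    linarith
  -- At a fixed point the barrier equals `1` for large `k`, so the limit of this inequality is `1 ≤
  -- α L`.
  have hk : ∀ k, barrier (T k) (R k) y ≤ (α + D / T k) * L := fun k =>
    (h3 k).trans (mul_le_mul_of_nonneg_left (h4 k L fun n => le_ciSup hbdd n) (hκ k))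
  have hTlim : Tendsto T atTop atTop :=
    tendsto_atTop_add_const_right _ _ tendsto_natCast_atTop_atTop
  have hlim1 : Tendsto (fun k => (α + D / T k) * L) atTop (𝓝 ((α + 0) * L)) :=
    ((hTlim.const_div_atTop D).const_add α).mul_const L
  have hlim2 : Tendsto (fun k => barrier (T k) (R k) y) atTop (𝓝 1) := by
    refine tendsto_const_nhds.congr' ?_
    filter_upwards [hTlim.eventually_ge_atTop (max |y.1| |y.2|)] with k hk
    have hT0 : 0 < T k := zero_lt_one.trans_le (hT1 k)
    have hR0 : 0 < R k := hT0.trans_le (hTR k)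
    rw [barrier, bump_eq_one, bump_eq_one, one_mul]
    · rw [abs_div, abs_of_pos hR0, div_le_one hR0]
      exact (le_max_right _ _).trans (hk.trans (hTR k))
    · rw [abs_div, abs_of_pos hT0, div_le_one hT0]
      exact (le_max_left _ _).trans hk
  have hL : 1 ≤ α * L := by
    have := le_of_tendsto_of_tendsto' hlim2 hlim1 hk
    rwa [add_zero] at this
  have hL' : α * L = 1 := le_antisymm (by rwa [← le_inv_mul_iff₀ hα, mul_one]) hL
  simp only [h5, Pi.smul_apply, smul_eq_mul]
  refine ⟨fun m n hmn => mul_le_mul_of_nonneg_left (hm hmn) hα.le, ?_⟩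
  rw [oneE, indicator_of_mem hd, ← hL']
  exact hlim.const_mul α

end Admissible

end
end MovingDomain

theorem mainTheorem5 (c : MovingDomain.Data)
    (hsigma : 0 < c.sigma) (hdelta : 1 ≤ c.delta) (hb : 0 ≤ c.b) (hp0 : 0 < c.p) (hp1 : c.p < 1)
    (hlam : MovingDomain.MemH12loc c.lam) (hlam0 : ∀ t, 0 ≤ t → 0 ≤ c.lam t)
    (hdlam : MovingDomain.IsWeakDerivL2loc c.lam c.dlam)
    (hrho : MovingDomain.RhoMonotone c) :
    (∀ α : ℝ, 0 < α → ∀ f : MovingDomain.H c, ∃! g, MovingDomain.IsResolvent c α f g) ∧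
    (∀ α : ℝ, 0 < α →
      MovingDomain.IsSubMarkovian c (fun f => α • MovingDomain.resolvent c α f) ∧
      MovingDomain.ExtendsTo c (fun f => α • MovingDomain.resolvent c α f)
        (MovingDomain.oneE c) (MovingDomain.oneE c)) ∧
    MovingDomain.ExtendsTo c (MovingDomain.resolvent c 1)
      (MovingDomain.oneE c) (MovingDomain.oneE c) := by
  have hc : MovingDomain.Admissible c := ⟨hsigma, hdelta, hb, hp0, hp1, hdlam.1, hrho⟩
  refine ⟨fun α hα f => hc.existsUnique_isResolvent hα f,
    fun α hα => ⟨hc.isSubMarkovian hα, hc.extendsTo_one hα⟩, ?_⟩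
  have h := hc.extendsTo_one zero_lt_one
  simpa only [one_smul] using h
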